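/- Let $\eta(\tau)=q^{1/24}\prod_{n\ge1}(1-q^n)$, $q=e^{2\pi i\tau}$, $\operatorname{Im}\tau>0$, be the Dedekind eta function. For $r\in\{j/12: 1\le j\le 11\}$ put $$\mathbb{K}_3(r,1)(\tau)=\eta(\tau)^{9-12r}\,\eta(3\tau)^{12r-3},$$ $${}_3P_2(\mathrm{HD}_{\mathbb{K}_3}(r,1);1)=\frac{2\sqrt3}{3}\,\pi\,B(r,1-r)\sum_{k\ge0}\frac{(1/3)_k(2/3)_k(r)_k}{(k!)^3},$$ where $B$ is the Beta function and $(a)_k=a(a+1)\cdots(a+k-1)$, and write ${}_3P_2(r)$ for ${}_3P_2(\mathrm{HD}_{\mathbb{K}_3}(r,1);1)$. Let $\sqrt{-1}=i$ and $\sqrt{-n}=i\sqrt n$ for $n>0$, and consider the five functions on the upper half-plane (weight three Hecke eigenforms, named by their LMFDB labels) given by \begin{align*} f_{12.3.c.a}(\tau)&=\mathbb{K}_3(\tfrac12,1)(2\tau),\\ f_{27.3.b.b}(\tau)&=\mathbb{K}_3(\tfrac13,1)(3\tau)+3\sqrt{-1}\,\mathbb{K}_3(\tfrac23,1)(3\tau),\\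 f_{16.3.c.a}(\tau)&=\mathbb{K}_3(\tfrac14,1)(4\tau),\\ f_{108.3.c.b}(\tau)&=\mathbb{K}_3(\tfrac16,1)(6\tau)+9\sqrt{-1}\,\mathbb{K}_3(\tfrac56,1)(6\tau),\\ f_{432.3.g.e}(\tau)&=\mathbb{K}_3(\tfrac1{12},1)(12\tau)+3\sqrt5\,\mathbb{K}_3(\tfrac5{12},1)(12\tau)-3\sqrt{-15}\,\mathbb{K}_3(\tfrac7{12},1)(12\tau)-9\sqrt{-3}\,\mathbb{K}_3(\tfrac{11}{12},1)(12\tau). \end{align*} For such $f$ let $L(f,1)=-2\pi i\int_0^{i\infty}f(t)\,dt$, the integral being taken along the imaginary axis. Then the hypergeometric series above converge for all $r=j/12$, $1\le j\le 11$, the integrals defining the five values $L(f,1)$ converge absolutely, and \begin{align*} 12\pi\, L(f_{12.3.c.a},1)&={}_3P_2(\tfrac12),\\ 2\cdot3^{3/2}\pi\, L(f_{27.3.b.b},1)&={}_3P_2(\tfrac13)+\sqrt{-1}\;{}_3P_2(\tfrac23),\\ 8\cdot3^{1/4}\pi\, L(f_{16.3.c.a},1)&={}_3P_2(\tfrac14)=\tfrac1{\sqrt3}\;{}_3P_2(\tfrac34),\\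 12\pi\, L(f_{108.3.c.b},1)&={}_3P_2(\tfrac16)+\sqrt{-1}\;{}_3P_2(\tfrac56),\\ 8\cdot3^{5/4}\pi\, L(f_{432.3.g.e},1)&=\sqrt3\left[{}_3P_2(\tfrac1{12})+\sqrt5\;{}_3P_2(\tfrac5{12})\right]-\sqrt{-3}\left[\sqrt5\;{}_3P_2(\tfrac7{12})+{}_3P_2(\tfrac{11}{12})\right]. \end{align*} -/

import Mathlib

open Complex MeasureTheory Set

noncomputable section

/-- The `k`-th term `(a)_k (b)_k (c)_k / (k! (d)_k (e)_k) * z ^ k` of the classical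
hypergeometric series `₃F₂(a, b, c; d, e; z)`. -/
def threeFTwoTerm (a b c d e z : ℝ) (k : ℕ) : ℝ :=
  (ascPochhammer ℝ k).eval a * (ascPochhammer ℝ k).eval b * (ascPochhammer ℝ k).eval c /
    ((k.factorial : ℝ) * (ascPochhammer ℝ k).eval d * (ascPochhammer ℝ k).eval e) * z ^ k

/-- The classical hypergeometric series `₃F₂(a, b, c; d, e; z)`. -/
def threeFTwo (a b c d e z : ℝ) : ℝ := ∑' k : ℕ, threeFTwoTerm a b c d e z k

/-- The normalised value `₃P₂(HD(r,1); 1) = (2√3/3) π B(r, 1 - r) ₃F₂(1/3, 2/3, r; 1, 1; 1)`,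
for the datum `HD(r,1) = {{1/3, 2/3, r}, {1, 1, 1}}`. -/
def threePTwo (r : ℝ) : ℝ :=
  2 * √3 / 3 * Real.pi * ProbabilityTheory.beta r (1 - r) * threeFTwo (1 / 3) (2 / 3) r 1 1 1

/-- The eta-quotient `𝕂₃(r,1)(τ) = η(τ) ^ (9 - 12 r) * η(3τ) ^ (12 r - 3)` with `r = j / 12`. -/
def kThree (j : ℤ) (τ : ℂ) : ℂ :=
  ModularForm.eta τ ^ (9 - j) * ModularForm.eta (3 * τ) ^ (j - 3)

/-- The value `L(f, 1) = -2πi ∫_0^{i∞} f(t) dt`, the path being `t = i y` with `0 < y < ∞`. -/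
def lValueOne (f : ℂ → ℂ) : ℂ :=
  -2 * Real.pi * I * ∫ y in Ioi (0 : ℝ), f (I * y) * I

/-- Convergence of the integral that defines `L(f, 1)`. -/
def LValueOneConverges (f : ℂ → ℂ) : Prop :=
  IntegrableOn (fun y : ℝ => f (I * y) * I) (Ioi 0)

/-- `f_{12.3.c.a}(τ) = 𝕂₃(1/2,1)(2τ)`. -/
def f_12_3_c_a (τ : ℂ) : ℂ := kThree 6 (2 * τ)

/-- `f_{27.3.b.b}(τ) = 𝕂₃(1/3,1)(3τ) + 3 √-1 𝕂₃(2/3,1)(3τ)`. -/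
def f_27_3_b_b (τ : ℂ) : ℂ := kThree 4 (3 * τ) + 3 * I * kThree 8 (3 * τ)

/-- `f_{16.3.c.a}(τ) = 𝕂₃(1/4,1)(4τ)`. -/
def f_16_3_c_a (τ : ℂ) : ℂ := kThree 3 (4 * τ)

/-- `f_{108.3.c.b}(τ) = 𝕂₃(1/6,1)(6τ) + 9 √-1 𝕂₃(5/6,1)(6τ)`. -/
def f_108_3_c_b (τ : ℂ) : ℂ := kThree 2 (6 * τ) + 9 * I * kThree 10 (6 * τ)

/-- `f_{432.3.g.e}(τ) = 𝕂₃(1/12,1)(12τ) + 3 √5 𝕂₃(5/12,1)(12τ) - 3 √-15 𝕂₃(7/12,1)(12τ)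
- 9 √-3 𝕂₃(11/12,1)(12τ)`, with `√-n = i √n`. -/
def f_432_3_g_e (τ : ℂ) : ℂ :=
  kThree 1 (12 * τ) + 3 * (√5 : ℝ) * kThree 5 (12 * τ)
    - 3 * (I * (√15 : ℝ)) * kThree 7 (12 * τ) - 9 * (I * (√3 : ℝ)) * kThree 11 (12 * τ)

end

/-! On the imaginary axis write `b = η(τ)^9/η(3τ)^3` and `c = 27 η(3τ)^9/η(τ)^3` (the cubes of the
Borwein cubic theta functions), `a^3 = b + c` and `x = c/(b + c)`. With `r = j/12`, the eta-quotient
`𝕂₃(r,1)` is `27^(-r) c^r b^(1-r)`, that is, `27^(-r) a^3 x^r (1-x)^(1-r)`. Two classical facts,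
`dx/dy = -2π a^2 x(1-x)` and `a = ₂F₁(1/3, 2/3; 1; x)`, turn `∫ c^r b^(1-r) dy` into `(1/2π) ∫
₂F₁(x) x^(r-1) (1-x)^(-r) dx` over `(0,1)`, which is Euler's integral for the `₃F₂`. Each `L(f,1)`
is a linear combination of such integrals, rescaled by the level of the argument.

The two facts rest on differential equations. Let `s` and `p` be the logarithmic derivatives of
`η(z)η(3z)` and `η(3z)/η(z)`. The identities needed are the Riccati equation `s' = s^2 - 4p^2`
(`hasDerivAt_etaLogS'`) and the algebraic relation between `p^3` and `(b + c)^2` (`etaLogP_cube`).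
In both, the defect is a modular form for the group generated by `z ↦ z + 1` and the Fricke
involution. Divided by a suitable power of `η(z)η(3z)` it has weight zero, hence is constant by the
maximum principle (`eqOn_const_of_norm_fricke`), and the constant is zero by evaluation at the cusp
or at an elliptic point.

These identities give the real system `IsCubicSystem`. In it `a` and `x(1-x) da/dx` satisfy, as
functions of `x`, the same first-order system as `F = ₂F₁` and `x(1-x)F'`. A Wronskian argument with
limits at `x = 0` gives `a = F(x)` (`cubeRoot_eq_hypF`), and `integrableOn_and_integral` carries out
the substitution. -/

noncomputable section

/-! ### A maximum principle for the Fricke group of level three -/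

open Function.Periodic in
/-- Holomorphic functions of `q = exp (2πiz)` whose modulus is invariant under the Fricke
involution `z ↦ -1 / (3 z)` are constant. -/
theorem eqOn_const_of_norm_fricke {F : ℂ → ℂ} (hF : DifferentiableOn ℂ F (Metric.ball 0 1))
    (hW : ∀ z : ℂ, 0 < z.im → ‖F (qParam 1 (-1 / (3 * z)))‖ = ‖F (qParam 1 z)‖) :
    EqOn F (Function.const ℂ (F 0)) (Metric.ball 0 1) := by
  have key : ∀ n : ℕ, ∀ z : ℂ, 0 < z.im → (15 / 16 : ℝ) ^ n / 4 ≤ z.im →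
      ∃ w : ℂ, 1 / 4 ≤ w.im ∧ ‖F (qParam 1 z)‖ = ‖F (qParam 1 w)‖ := by
    intro n
    induction n with
    | zero => intro z _ hz; exact ⟨z, by simpa using hz, rfl⟩
    | succ n ih =>
      intro z hz0 hz
      by_cases h4 : 1 / 4 ≤ z.im
      · exact ⟨z, h4, rfl⟩
      push Not at h4
      set u : ℂ := z - (round z.re : ℤ) with hu
      have hui : u.im = z.im := by simp [hu]
      have hur : |u.re| ≤ 1 / 2 := by simpa [hu] using abs_sub_round z.re
      have hqu : qParam 1 u = qParam 1 z := by
        simp only [qParam, hu]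
        rw [Complex.exp_eq_exp_iff_exists_int]
        exact ⟨-round z.re, by push_cast; ring⟩
      have hnu : 0 < normSq u := by
        rw [normSq_pos]; rintro h; rw [h] at hui; simp at hui; linarith
      -- Here `|u|^2 ≤ (1/2)^2 + (1/4)^2 = 5/16`, so the involution raises the imaginary part by a
      -- factor of at least `16/15`. Finitely many steps reach height `1/4`.
      have hns : 3 * normSq u ≤ 15 / 16 := by
        rw [normSq_apply, hui]
        have := abs_le.mp hur
        nlinarith
      have him : (-1 / (3 * u)).im = z.im / (3 * normSq u) := by
        have : (-1 / (3 * u) : ℂ) = ((-1 / 3 : ℝ) : ℂ) * u⁻¹ := by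
          push_cast
          rw [div_mul_eq_div_div, div_eq_mul_inv (-1 / 3 : ℂ)]
        rw [this, im_ofReal_mul, inv_im, hui]
        field_simp
      have hpos : 0 < (-1 / (3 * u)).im := by rw [him]; positivity
      obtain ⟨w, hw, hw'⟩ := ih (-1 / (3 * u)) hpos (by
        rw [him, le_div_iff₀ (by positivity)]
        rw [pow_succ] at hz
        have : 0 < (15 / 16 : ℝ) ^ n := by positivity
        nlinarith)
      exact ⟨w, hw, by rw [← hqu, ← hW u (by rw [hui]; exact hz0), hw']⟩
  -- Height at least `1/4` means `|q| ≤ exp(-π/2) < 1`. Every value of `‖F‖` is thus attained on a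
  -- compact subdisc, and the maximum principle applies.
  refine eq_const_of_exists_le (r := Real.exp (-2 * Real.pi * (1 / 4) / 1)) hF (by positivity)
    (by rw [Real.exp_lt_one_iff]; nlinarith [Real.pi_pos]) fun q hq ↦ ?_
  rcases eq_or_ne q 0 with rfl | hq0
  · exact ⟨0, by simp; positivity, le_rfl⟩
  have hqz : qParam 1 (invQParam 1 q) = q := qParam_right_inv one_ne_zero hq0
  have hz : 0 < (invQParam 1 q).im := by
    have := norm_qParam_lt_iff one_pos 0 (invQParam 1 q)
    rw [hqz] at this
    exact this.mp (by simpa using hq)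
  obtain ⟨n, hn⟩ := exists_pow_lt_of_lt_one (y := (15 / 16 : ℝ)) (mul_pos four_pos hz) (by norm_num)
  obtain ⟨w, hw, hw'⟩ := key n _ hz (by linarith)
  refine ⟨qParam 1 w, ?_, by rw [← hw', hqz]⟩
  rw [mem_closedBall_zero_iff, norm_qParam, Real.exp_le_exp]
  have := Real.pi_pos
  nlinarith

/-! ### Modular identities for `η(z)` and `η(3z)` -/

namespace EtaThree

open ModularForm Function.Periodic

/-- The Euler product `∏ (1 - q ^ n)`. -/
def euler (q : ℂ) : ℂ := ∏' n : ℕ, (1 - q ^ (n + 1))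

theorem differentiableOn_euler : DifferentiableOn ℂ euler (Metric.ball 0 1) :=
  differentiableOn_tprod_one_sub_pow

theorem euler_zero : euler 0 = 1 := by simp [euler]

theorem qParam_mem_ball {z : ℂ} (hz : 0 < z.im) : qParam 1 z ∈ Metric.ball (0 : ℂ) 1 := by
  simpa using norm_qParam_lt_one one_pos hz

theorem eta_eq (z : ℂ) : η z = cexp (2 * Real.pi * I * z / 24) * euler (qParam 1 z) := by
  simp [ModularForm.eta, euler, eta_q, qParam]

theorem exists_qParam {q : ℂ} (hq : q ∈ Metric.ball (0 : ℂ) 1) (hq0 : q ≠ 0) :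
    ∃ z : ℂ, 0 < z.im ∧ qParam 1 z = q := by
  have hqz : qParam 1 (invQParam 1 q) = q := qParam_right_inv one_ne_zero hq0
  refine ⟨_, ?_, hqz⟩
  have := norm_qParam_lt_iff one_pos 0 (invQParam 1 q)
  rw [hqz] at this
  exact this.mp (by simpa using hq)

theorem euler_ne_zero {q : ℂ} (hq : q ∈ Metric.ball (0 : ℂ) 1) : euler q ≠ 0 := by
  rcases eq_or_ne q 0 with rfl | hq0
  · simp [euler_zero]
  obtain ⟨z, hz, rfl⟩ := exists_qParam hq hq0
  have := ModularForm.eta_ne_zero (z := z) hz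
  rw [eta_eq] at this
  exact right_ne_zero_of_mul this

theorem differentiableOn_deriv_euler : DifferentiableOn ℂ (deriv euler) (Metric.ball 0 1) :=
  differentiableOn_euler.deriv Metric.isOpen_ball

/-- The part of `logDeriv eta` without constant term, as a function of `q`. -/
def etaLogQ (q : ℂ) : ℂ := 2 * Real.pi * I * (q * deriv euler q / euler q)

theorem differentiableOn_etaLogQ : DifferentiableOn ℂ etaLogQ (Metric.ball 0 1) :=
  ((differentiableOn_id.mul differentiableOn_deriv_euler).div differentiableOn_euler
    fun _ h ↦ euler_ne_zero h).const_mul _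

theorem etaLogQ_zero : etaLogQ 0 = 0 := by simp [etaLogQ]

theorem hasDerivAt_qParam (z : ℂ) :
    HasDerivAt (qParam 1) (2 * Real.pi * I * qParam 1 z) z := by
  have : HasDerivAt (fun z : ℂ ↦ 2 * Real.pi * I * z / (1 : ℝ)) (2 * Real.pi * I) z := by
    simpa using (hasDerivAt_id z).const_mul (2 * Real.pi * I)
  convert! this.cexp using 1
  rw [mul_comm, qParam]

theorem hasDerivAt_comp_qParam {F : ℂ → ℂ} (hF : DifferentiableOn ℂ F (Metric.ball 0 1)) {z : ℂ}
    (hz : 0 < z.im) :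
    HasDerivAt (fun z ↦ F (qParam 1 z)) (2 * Real.pi * I * (qParam 1 z * deriv F (qParam 1 z))) z := by
  have h1 := (hF.differentiableAt (Metric.isOpen_ball.mem_nhds (qParam_mem_ball hz))).hasDerivAt
  convert! h1.comp z (hasDerivAt_qParam z) using 1
  ring

/-- The logarithmic derivative of the eta function. -/
def etaLog (z : ℂ) : ℂ := Real.pi * I / 12 + etaLogQ (qParam 1 z)

theorem hasDerivAt_eta {z : ℂ} (hz : 0 < z.im) : HasDerivAt η (etaLog z * η z) z := by
  have h1 : HasDerivAt (fun z : ℂ ↦ cexp (2 * Real.pi * I * z / 24))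
      (cexp (2 * Real.pi * I * z / 24) * (2 * Real.pi * I / 24)) z := by
    have : HasDerivAt (fun z : ℂ ↦ 2 * Real.pi * I * z / 24) (2 * Real.pi * I / 24) z := by
      simpa using ((hasDerivAt_id z).const_mul (2 * Real.pi * I)).div_const 24
    exact this.cexp
  have h := h1.mul (hasDerivAt_comp_qParam differentiableOn_euler hz)
  have h0 := euler_ne_zero (qParam_mem_ball hz)
  rw [show η = _ from funext eta_eq]
  convert! h using 1
  simp only [etaLog, etaLogQ]
  field_simp
  ring

theorem qParam_add_one (z : ℂ) : qParam 1 (z + 1) = qParam 1 z := by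
  simp only [qParam]
  rw [Complex.exp_eq_exp_iff_exists_int]
  exact ⟨1, by push_cast; ring⟩

theorem qParam_three_mul (z : ℂ) : qParam 1 (3 * z) = qParam 1 z ^ 3 := by
  simp only [qParam, ← Complex.exp_nat_mul]
  congr 1
  push_cast
  ring

theorem im_neg_inv {z : ℂ} (hz : 0 < z.im) : 0 < (-1 / z).im := by
  have := UpperHalfPlane.im_inv_neg_coe_pos ⟨z, hz⟩
  simpa [neg_div] using this

theorem ne_zero_of_im_pos {z : ℂ} (hz : 0 < z.im) : z ≠ 0 := by
  rintro rfl; simp at hz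

theorem eta_neg_inv {z : ℂ} (hz : 0 < z.im) :
    η (-1 / z) = (sqrt I)⁻¹ * sqrt z * η z := by
  have := eta_comp_eq_csqrt_I_inv hz
  simpa [mul_assoc] using this

theorem sqrt_sq' (z : ℂ) : sqrt z ^ 2 = z := by
  simp [sqrt]

theorem sqrt_three_mul {z : ℂ} (hz : z ≠ 0) : sqrt (3 * z) = (√3 : ℝ) * sqrt z := by
  rw [sqrt_eq_exp (by simpa using hz), sqrt_eq_exp hz,
    show (3 : ℂ) * z = ((3 : ℝ) : ℂ) * z by simp, log_ofReal_mul (by norm_num) hz, add_div,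
    Complex.exp_add, Real.sqrt_eq_rpow, Real.rpow_def_of_pos (by norm_num)]
  push_cast
  ring_nf

/-- The automorphy factor of the eta function under `z ↦ -1 / z`. -/
def etaFactor (z : ℂ) : ℂ := (sqrt I)⁻¹ * sqrt z

theorem etaFactor_sq (z : ℂ) : etaFactor z ^ 2 = z / I := by
  rw [etaFactor, mul_pow, inv_pow, sqrt_sq', sqrt_sq']
  field_simp

theorem etaFactor_ne_zero {z : ℂ} (hz : z ≠ 0) : etaFactor z ≠ 0 := by
  intro h
  have := etaFactor_sq z
  rw [h] at this
  simp [hz] at this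

theorem fricke_im_pos {z : ℂ} (hz : 0 < z.im) : 0 < (-1 / (3 * z)).im :=
  im_neg_inv (by simpa using hz)

theorem three_mul_im_pos {z : ℂ} (hz : 0 < z.im) : 0 < (3 * z).im := by simpa using hz

theorem eta_fricke {z : ℂ} (hz : 0 < z.im) :
    η (-1 / (3 * z)) = (√3 : ℝ) * etaFactor z * η (3 * z) := by
  rw [eta_neg_inv (three_mul_im_pos hz), sqrt_three_mul (ne_zero_of_im_pos hz), etaFactor]
  ring

theorem three_mul_fricke {z : ℂ} (hz : 0 < z.im) : 3 * (-1 / (3 * z)) = -1 / z := by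
  have := ne_zero_of_im_pos hz
  field_simp

theorem eta_three_fricke {z : ℂ} (hz : 0 < z.im) :
    η (3 * (-1 / (3 * z))) = etaFactor z * η z := by
  rw [three_mul_fricke hz, eta_neg_inv hz, etaFactor]

theorem hasDerivAt_sqrt {z : ℂ} (hz : 0 < z.im) : HasDerivAt sqrt (sqrt z / (2 * z)) z := by
  have hz0 := ne_zero_of_im_pos hz
  have h : z ∈ slitPlane := Or.inr hz.ne'
  convert! (differentiableAt_sqrt h).hasDerivAt using 1
  have h1 : (z ^ (2⁻¹ : ℂ)) ^ 2 = z := sqrt_sq' z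
  have h2 : z ^ (2⁻¹ : ℂ) ≠ 0 := by simp [hz0]
  rw [deriv_sqrt h, sqrt, show (-1 / 2 : ℂ) = -2⁻¹ by norm_num, cpow_neg]
  generalize z ^ (2⁻¹ : ℂ) = w at *
  field_simp
  exact h1

theorem eta_ne_zero' {z : ℂ} (hz : 0 < z.im) : η z ≠ 0 := ModularForm.eta_ne_zero hz

/-- The quasimodularity of `E₂`, obtained by differentiating the transformation law of `η`; the term
`z / 2` comes from the factor `sqrt z`. -/
theorem etaLog_neg_inv {z : ℂ} (hz : 0 < z.im) :
    etaLog (-1 / z) = z ^ 2 * etaLog z + z / 2 := by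
  have hz0 := ne_zero_of_im_pos hz
  have h1 : HasDerivAt (fun z : ℂ ↦ -1 / z) (1 / z ^ 2) z := by
    convert! (hasDerivAt_inv hz0).neg using 1
    · ext w; simp [div_eq_mul_inv]
    · simp
  have h2 := (hasDerivAt_eta (im_neg_inv hz)).comp z h1
  have h3 := ((hasDerivAt_sqrt hz).const_mul (sqrt I)⁻¹).mul (hasDerivAt_eta hz)
  have h4 := h2.unique (h3.congr_of_eventuallyEq (by
    filter_upwards [(isOpen_lt continuous_const continuous_im).mem_nhds hz] with w hw
    simpa using! eta_neg_inv hw))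
  rw [eta_neg_inv hz] at h4
  have h5 := eta_ne_zero' hz
  have h6 : sqrt I ≠ 0 := fun h ↦ I_ne_zero (by simpa [h] using (sqrt_sq' I).symm)
  have h7 : sqrt z ≠ 0 := fun h ↦ hz0 (by simpa [h] using (sqrt_sq' z).symm)
  rw [neg_div] at h4 ⊢
  field_simp at h4
  linear_combination h4 / 2

/-- The logarithmic derivative of `η (3 z) / η z`, a form of weight two. -/
def etaLogP (z : ℂ) : ℂ := 3 * etaLog (3 * z) - etaLog z

/-- The logarithmic derivative of `η (3 z) * η z`. -/
def etaLogS (z : ℂ) : ℂ := 3 * etaLog (3 * z) + etaLog z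

/-- `etaLogP` as a function of `q`. -/
def etaLogPQ (q : ℂ) : ℂ := Real.pi * I / 6 + (3 * etaLogQ (q ^ 3) - etaLogQ q)

/-- `etaLogS` as a function of `q`. -/
def etaLogSQ (q : ℂ) : ℂ := Real.pi * I / 3 + (3 * etaLogQ (q ^ 3) + etaLogQ q)

theorem etaLogP_eq (z : ℂ) : etaLogP z = etaLogPQ (qParam 1 z) := by
  rw [etaLogP, etaLogPQ, etaLog, etaLog, qParam_three_mul]
  ring

theorem etaLogS_eq (z : ℂ) : etaLogS z = etaLogSQ (qParam 1 z) := by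
  rw [etaLogS, etaLogSQ, etaLog, etaLog, qParam_three_mul]
  ring

theorem mapsTo_pow_three :
    MapsTo (fun q : ℂ ↦ q ^ 3) (Metric.ball 0 1) (Metric.ball 0 1) := by
  intro q hq
  simp only [mem_ball_zero_iff, norm_pow] at hq ⊢
  exact pow_lt_one₀ (norm_nonneg _) hq (by norm_num)

theorem differentiableOn_comp_pow_three {F : ℂ → ℂ} (hF : DifferentiableOn ℂ F (Metric.ball 0 1)) :
    DifferentiableOn ℂ (fun q ↦ F (q ^ 3)) (Metric.ball 0 1) :=
  hF.comp (by fun_prop) mapsTo_pow_three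

theorem differentiableOn_etaLogPQ : DifferentiableOn ℂ etaLogPQ (Metric.ball 0 1) :=
  (((differentiableOn_comp_pow_three differentiableOn_etaLogQ).const_mul 3).sub
    differentiableOn_etaLogQ).const_add _

theorem differentiableOn_etaLogSQ : DifferentiableOn ℂ etaLogSQ (Metric.ball 0 1) :=
  (((differentiableOn_comp_pow_three differentiableOn_etaLogQ).const_mul 3).add
    differentiableOn_etaLogQ).const_add _

/-- The inhomogeneous terms of `etaLog` cancel in the difference, so `etaLogP` is modular; in the
sum `etaLogS` they survive. -/
theorem etaLogP_fricke {z : ℂ} (hz : 0 < z.im) :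
    etaLogP (-1 / (3 * z)) = -3 * z ^ 2 * etaLogP z := by
  rw [etaLogP, three_mul_fricke hz, etaLog_neg_inv hz, etaLog_neg_inv (three_mul_im_pos hz),
    etaLogP]
  ring

theorem etaLogS_fricke {z : ℂ} (hz : 0 < z.im) :
    etaLogS (-1 / (3 * z)) = 3 * z ^ 2 * etaLogS z + 3 * z := by
  rw [etaLogS, three_mul_fricke hz, etaLog_neg_inv hz, etaLog_neg_inv (three_mul_im_pos hz),
    etaLogS]
  ring

/-- The derivative of `etaLogS` as a function of `q`. -/
def derivEtaLogSQ (q : ℂ) : ℂ := 2 * Real.pi * I * (q * deriv etaLogSQ q)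

theorem hasDerivAt_etaLogS {z : ℂ} (hz : 0 < z.im) :
    HasDerivAt etaLogS (derivEtaLogSQ (qParam 1 z)) z := by
  rw [show etaLogS = _ from funext etaLogS_eq]
  exact hasDerivAt_comp_qParam differentiableOn_etaLogSQ hz

theorem derivEtaLogSQ_fricke {z : ℂ} (hz : 0 < z.im) :
    derivEtaLogSQ (qParam 1 (-1 / (3 * z))) =
      3 * z ^ 2 * (3 * z ^ 2 * derivEtaLogSQ (qParam 1 z) + 6 * z * etaLogS z + 3) := by
  have hz0 := ne_zero_of_im_pos hz
  have h1 : HasDerivAt (fun z : ℂ ↦ -1 / (3 * z)) (1 / (3 * z ^ 2)) z := by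
    convert! (hasDerivAt_inv hz0).const_mul (-1 / 3) using 1
    · ext w; rw [div_mul_eq_div_div, div_eq_mul_inv (-1 / 3 : ℂ)]
    · field_simp
  have h2 := (hasDerivAt_etaLogS (fricke_im_pos hz)).comp z h1
  have h3 := ((((hasDerivAt_id z).pow 2).const_mul 3).mul (hasDerivAt_etaLogS hz)).add
    ((hasDerivAt_id z).const_mul 3)
  have h4 := h2.unique (h3.congr_of_eventuallyEq (by
    filter_upwards [(isOpen_lt continuous_const continuous_im).mem_nhds hz] with w hw
    simpa using! etaLogS_fricke hw))
  simp only [id, Pi.pow_apply] at h4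
  generalize derivEtaLogSQ (qParam 1 (-1 / (3 * z))) = d at *
  field_simp at h4
  push_cast at h4
  linear_combination h4

/-- The defect in the Riccati equation for `etaLogS`, as a function of `q`. -/
def riccatiQ (q : ℂ) : ℂ := derivEtaLogSQ q - etaLogSQ q ^ 2 + 4 * etaLogPQ q ^ 2

theorem differentiableOn_riccatiQ : DifferentiableOn ℂ riccatiQ (Metric.ball 0 1) :=
  (((differentiableOn_id.mul
    (differentiableOn_etaLogSQ.deriv Metric.isOpen_ball)).const_mul _).sub
    (differentiableOn_etaLogSQ.pow 2)).add ((differentiableOn_etaLogPQ.pow 2).const_mul 4)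

theorem riccatiQ_zero : riccatiQ 0 = 0 := by
  simp [riccatiQ, derivEtaLogSQ, etaLogSQ, etaLogPQ, etaLogQ_zero]
  ring

/-- The anomalous terms `18 z^3 s + 9 z^2` of the derivative are exactly those of `s^2`, so the
defect is modular of weight four. -/
theorem riccatiQ_fricke {z : ℂ} (hz : 0 < z.im) :
    riccatiQ (qParam 1 (-1 / (3 * z))) = 9 * z ^ 4 * riccatiQ (qParam 1 z) := by
  rw [riccatiQ, derivEtaLogSQ_fricke hz, ← etaLogS_eq, ← etaLogP_eq, etaLogS_fricke hz,
    etaLogP_fricke hz, riccatiQ, etaLogS_eq, etaLogP_eq]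
  ring

theorem zero_mem_ball : (0 : ℂ) ∈ Metric.ball (0 : ℂ) 1 := by simp

theorem mul_dslope {F : ℂ → ℂ} (h : F 0 = 0) (q : ℂ) : q * dslope F 0 q = F q := by
  have := sub_smul_dslope F 0 q
  simpa [h] using this

/-- `η z * η (3 z)` divided by `q ^ (1 / 6)`, as a function of `q`. -/
def eulerProd (q : ℂ) : ℂ := euler q * euler (q ^ 3)

theorem differentiableOn_eulerProd : DifferentiableOn ℂ eulerProd (Metric.ball 0 1) :=
  differentiableOn_euler.mul (differentiableOn_comp_pow_three differentiableOn_euler)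

theorem eulerProd_ne_zero {q : ℂ} (hq : q ∈ Metric.ball (0 : ℂ) 1) : eulerProd q ≠ 0 :=
  mul_ne_zero (euler_ne_zero hq) (euler_ne_zero (mapsTo_pow_three hq))

theorem eta_mul_eta_pow_six (z : ℂ) :
    (η z * η (3 * z)) ^ 6 = qParam 1 z * eulerProd (qParam 1 z) ^ 6 := by
  rw [eta_eq, eta_eq, qParam_three_mul, eulerProd, mul_mul_mul_comm, ← Complex.exp_add, mul_pow,
    ← Complex.exp_nat_mul]
  congr 1
  rw [qParam]
  congr 1
  push_cast
  ring

theorem I_pow_six : I ^ 6 = -1 := by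
  rw [show 6 = 4 + 2 by rfl, pow_add, I_pow_four, I_sq, one_mul]

theorem sqrt_three_sq : ((√3 : ℝ) : ℂ) ^ 2 = 3 := by
  norm_cast
  simp

theorem eta_mul_eta_pow_six_fricke {z : ℂ} (hz : 0 < z.im) :
    (η (-1 / (3 * z)) * η (3 * (-1 / (3 * z)))) ^ 6 =
      -27 * z ^ 6 * (η z * η (3 * z)) ^ 6 := by
  rw [eta_three_fricke hz, eta_fricke hz]
  have : ((√3 : ℝ) * etaFactor z * η (3 * z) * (etaFactor z * η z)) ^ 6 =
    (((√3 : ℝ) : ℂ) ^ 2) ^ 3 * (etaFactor z ^ 2) ^ 6 * (η z * η (3 * z)) ^ 6 := by ring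
  rw [this, sqrt_three_sq, etaFactor_sq, div_pow, I_pow_six]
  ring

theorem riccatiQ_eq_zero {z : ℂ} (hz : 0 < z.im) : riccatiQ (qParam 1 z) = 0 := by
  -- This is `riccati^3 / (η(z)η(3z))^12`, of weight `12 - 12 = 0`. The numerator vanishes at the
  -- cusp to order at least three and the denominator to order two, so a factor `q` remains and the
  -- constant is `F 0 = 0`.
  set F : ℂ → ℂ := fun q ↦ dslope riccatiQ 0 q ^ 3 * q / eulerProd q ^ 12 with hF
  have hFd : DifferentiableOn ℂ F (Metric.ball 0 1) :=
    ((((Complex.differentiableOn_dslope (Metric.isOpen_ball.mem_nhds zero_mem_ball)).mpr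
      differentiableOn_riccatiQ).pow 3).mul differentiableOn_id).div
      (differentiableOn_eulerProd.pow 12) fun q hq ↦ pow_ne_zero _ (eulerProd_ne_zero hq)
  have hFz : ∀ z : ℂ, 0 < z.im →
      F (qParam 1 z) = riccatiQ (qParam 1 z) ^ 3 / ((η z * η (3 * z)) ^ 6) ^ 2 := by
    intro z hz
    rw [eta_mul_eta_pow_six, ← mul_dslope riccatiQ_zero]
    have := qParam_ne_zero (h := 1) z
    have := eulerProd_ne_zero (qParam_mem_ball hz)
    simp only [hF]
    field_simp
  have hc := eqOn_const_of_norm_fricke hFd (fun z hz ↦ by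
    have hz0 := ne_zero_of_im_pos hz
    rw [hFz z hz, hFz _ (fricke_im_pos hz), riccatiQ_fricke hz, eta_mul_eta_pow_six_fricke hz]
    have := eta_ne_zero' hz
    have := eta_ne_zero' (three_mul_im_pos hz)
    congr 1
    field_simp
    ring_nf)
  have h0 := hc (qParam_mem_ball hz)
  rw [hFz z hz] at h0
  simpa [hF, eta_ne_zero' hz, eta_ne_zero' (three_mul_im_pos hz)] using h0

/-- The Riccati equation `s' = s ^ 2 - 4 p ^ 2` satisfied by the logarithmic derivatives
`s`, `p` of `η z * η (3 z)` and `η (3 z) / η z`. -/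
theorem hasDerivAt_etaLogS' {z : ℂ} (hz : 0 < z.im) :
    HasDerivAt etaLogS (etaLogS z ^ 2 - 4 * etaLogP z ^ 2) z := by
  have := hasDerivAt_etaLogS hz
  have h := riccatiQ_eq_zero hz
  rw [riccatiQ, ← etaLogS_eq, ← etaLogP_eq] at h
  rwa [show derivEtaLogSQ (qParam 1 z) = etaLogS z ^ 2 - 4 * etaLogP z ^ 2 by
    linear_combination h] at this

/-- The sum `b ^ 3 + c ^ 3` of the cubes of the cubic theta functions. -/
def cubeSum (z : ℂ) : ℂ := η z ^ 9 / η (3 * z) ^ 3 + 27 * (η (3 * z) ^ 9 / η z ^ 3)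

/-- `cubeSum` as a function of `q`. -/
def cubeSumQ (q : ℂ) : ℂ :=
  euler q ^ 9 / euler (q ^ 3) ^ 3 + 27 * (q * euler (q ^ 3) ^ 9 / euler q ^ 3)

theorem cubeSum_eq {z : ℂ} (hz : 0 < z.im) : cubeSum z = cubeSumQ (qParam 1 z) := by
  rw [cubeSum, cubeSumQ, eta_eq, eta_eq, qParam_three_mul]
  have h1 := euler_ne_zero (qParam_mem_ball hz)
  have h2 := euler_ne_zero (mapsTo_pow_three (qParam_mem_ball hz))
  set e : ℂ := cexp (2 * Real.pi * I * z / 24) with he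
  have he0 : e ≠ 0 := Complex.exp_ne_zero _
  have he3 : cexp (2 * Real.pi * I * (3 * z) / 24) = e ^ 3 := by
    rw [he, ← Complex.exp_nat_mul]; congr 1; push_cast; ring
  have heq : qParam 1 z = e ^ 24 := by
    rw [he, ← Complex.exp_nat_mul, qParam]; congr 1; push_cast; ring
  rw [he3]
  generalize euler (qParam 1 z ^ 3) = a at *
  generalize euler (qParam 1 z) = b at *
  rw [heq]
  field_simp

theorem differentiableOn_cubeSumQ : DifferentiableOn ℂ cubeSumQ (Metric.ball 0 1) := by
  have h1 := differentiableOn_euler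
  have h3 := differentiableOn_comp_pow_three differentiableOn_euler
  exact ((h1.pow 9).div (h3.pow 3) fun q hq ↦
    pow_ne_zero _ (euler_ne_zero (mapsTo_pow_three hq))).add
    (((differentiableOn_id.mul (h3.pow 9)).div (h1.pow 3) fun q hq ↦
      pow_ne_zero _ (euler_ne_zero hq)).const_mul 27)

/-- The involution exchanges the two summands up to a common factor; the coefficient `27` is what
makes this work. -/
theorem cubeSum_fricke {z : ℂ} (hz : 0 < z.im) :
    cubeSum (-1 / (3 * z)) = 3 * (√3 : ℝ) * (z / I) ^ 3 * cubeSum z := by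
  rw [cubeSum, eta_three_fricke hz, eta_fricke hz, ← etaFactor_sq, cubeSum]
  have h1 := eta_ne_zero' hz
  have h2 := eta_ne_zero' (three_mul_im_pos hz)
  have h3 := etaFactor_ne_zero (ne_zero_of_im_pos hz)
  have h4 : ((√3 : ℝ) : ℂ) ≠ 0 := by simp
  have h5 := sqrt_three_sq
  generalize ((√3 : ℝ) : ℂ) = t at *
  have h6 : t ^ 9 = 81 * t := by rw [show t ^ 9 = (t ^ 2) ^ 4 * t by ring, h5]; norm_num
  have h7 : t ^ 3 = 3 * t := by rw [show t ^ 3 = t ^ 2 * t by ring, h5]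
  simp only [mul_pow, h6, h7]
  field_simp
  linear_combination (-9 * η z ^ 12) * h5

/-- The difference `P ^ 3 - (b ^ 3 + c ^ 3) ^ 2` as a function of `q`. -/
def cubeDefectQ (q : ℂ) : ℂ := (6 / (Real.pi * I) * etaLogPQ q) ^ 3 - cubeSumQ q ^ 2

theorem pi_I_ne_zero : (Real.pi * I : ℂ) ≠ 0 := by simp [Real.pi_ne_zero]

theorem cubeDefectQ_zero : cubeDefectQ 0 = 0 := by
  have := pi_I_ne_zero
  simp only [cubeDefectQ, etaLogPQ, cubeSumQ]
  norm_num [etaLogQ_zero, euler_zero]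

theorem differentiableOn_cubeDefectQ : DifferentiableOn ℂ cubeDefectQ (Metric.ball 0 1) :=
  ((differentiableOn_etaLogPQ.const_mul _).pow 3).sub (differentiableOn_cubeSumQ.pow 2)

theorem cubeDefectQ_fricke {z : ℂ} (hz : 0 < z.im) :
    cubeDefectQ (qParam 1 (-1 / (3 * z))) = -27 * z ^ 6 * cubeDefectQ (qParam 1 z) := by
  rw [cubeDefectQ, ← etaLogP_eq, ← cubeSum_eq (fricke_im_pos hz), etaLogP_fricke hz,
    cubeSum_fricke hz, cubeDefectQ, ← etaLogP_eq, ← cubeSum_eq hz]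
  have h5 := sqrt_three_sq
  have h6 := I_pow_six
  have h7 := I_ne_zero
  generalize ((√3 : ℝ) : ℂ) = t at *
  rw [show (3 * t * (z / I) ^ 3 * cubeSum z) ^ 2 = 9 * t ^ 2 * (z ^ 6 / I ^ 6) * cubeSum z ^ 2 by
    field_simp; ring, h5, h6]
  ring

/-- The elliptic point of order six of the Fricke group of level three. -/
def ellipticPoint : ℂ := ⟨1 / 2, √3 / 6⟩

theorem ellipticPoint_im_pos : 0 < ellipticPoint.im := by
  simp [ellipticPoint]

theorem ellipticPoint_eq : ellipticPoint = 1 / 2 + (√3 : ℝ) / 6 * I := by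
  apply Complex.ext <;> simp [ellipticPoint]

theorem ellipticPoint_fricke : -1 / (3 * ellipticPoint) + 1 = ellipticPoint := by
  have h := ne_zero_of_im_pos ellipticPoint_im_pos
  have h3 : 3 * ellipticPoint ^ 2 - 3 * ellipticPoint + 1 = 0 := by
    rw [ellipticPoint_eq]
    linear_combination (1 / 12 * I ^ 2) * sqrt_three_sq + 1 / 4 * I_sq
  field_simp
  linear_combination -h3

theorem qParam_ellipticPoint :
    qParam 1 (-1 / (3 * ellipticPoint)) = qParam 1 ellipticPoint := by
  rw [← qParam_add_one, ellipticPoint_fricke]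

/-- The Fricke involution followed by a translation fixes the point, and the automorphy factor `-3
z^2` there is not `1`. -/
theorem etaLogP_ellipticPoint : etaLogP ellipticPoint = 0 := by
  have h := etaLogP_fricke ellipticPoint_im_pos
  rw [etaLogP_eq, qParam_ellipticPoint, ← etaLogP_eq] at h
  have h2 : 1 + 3 * ellipticPoint ^ 2 ≠ 0 := by
    intro h0
    have := congrArg Complex.im h0
    rw [ellipticPoint, pow_two] at this
    norm_num at this
    nlinarith [Real.sqrt_pos.mpr (show (0 : ℝ) < 3 by norm_num)]
  have : (1 + 3 * ellipticPoint ^ 2) * etaLogP ellipticPoint = 0 := by linear_combination h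
  exact (mul_eq_zero.mp this).resolve_left h2

/-- At the fixed point the automorphy factor equals `-1`, because `√3 z / I` is a primitive sixth
root of unity. -/
theorem cubeSum_ellipticPoint : cubeSum ellipticPoint = 0 := by
  have h := cubeSum_fricke ellipticPoint_im_pos
  rw [cubeSum_eq (fricke_im_pos ellipticPoint_im_pos), qParam_ellipticPoint,
    ← cubeSum_eq ellipticPoint_im_pos] at h
  have h2 : 3 * (√3 : ℝ) * (ellipticPoint / I) ^ 3 = -1 := by
    have h6 := I_ne_zero
    have h7 := I_sq
    have h8 := sqrt_three_sq
    rw [ellipticPoint_eq]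
    generalize ((√3 : ℝ) : ℂ) = t at *
    have ht3 : t ^ 4 = 9 := by rw [show t ^ 4 = (t ^ 2) ^ 2 by ring, h8]; norm_num
    have hI : I ^ 3 = -I := by rw [show I ^ 3 = I ^ 2 * I by ring, h7]; ring
    field_simp
    ring_nf
    have ht2 : t ^ 3 = 3 * t := by rw [show t ^ 3 = t ^ 2 * t by ring, h8]
    simp only [ht3, ht2, h8, hI, h7]
    ring
  rw [h2] at h
  linear_combination h / 2

/-- In terms of cubic theta functions this is `(a^2)^3 = (b^3 + c^3)^2`: the normalised weight-two
form is `a^2`. -/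
theorem etaLogP_cube {z : ℂ} (hz : 0 < z.im) :
    (6 / (Real.pi * I) * etaLogP z) ^ 3 = cubeSum z ^ 2 := by
  -- The weight-six defect over `(η(z)η(3z))^6`, which has a simple zero at the cusp. No spare
  -- factor `q` is left here, so the cusp does not determine the constant; the elliptic point does.
  set F : ℂ → ℂ := fun q ↦ dslope cubeDefectQ 0 q / eulerProd q ^ 6 with hF
  have hFd : DifferentiableOn ℂ F (Metric.ball 0 1) :=
    ((Complex.differentiableOn_dslope (Metric.isOpen_ball.mem_nhds zero_mem_ball)).mpr
      differentiableOn_cubeDefectQ).div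
      (differentiableOn_eulerProd.pow 6) fun q hq ↦ pow_ne_zero _ (eulerProd_ne_zero hq)
  have hFz : ∀ z : ℂ, 0 < z.im →
      F (qParam 1 z) = cubeDefectQ (qParam 1 z) / (η z * η (3 * z)) ^ 6 := by
    intro z hz
    rw [eta_mul_eta_pow_six, ← mul_dslope cubeDefectQ_zero]
    have := qParam_ne_zero (h := 1) z
    have := eulerProd_ne_zero (qParam_mem_ball hz)
    simp only [hF]
    field_simp
  have hc := eqOn_const_of_norm_fricke hFd (fun z hz ↦ by
    have hz0 := ne_zero_of_im_pos hz
    rw [hFz z hz, hFz _ (fricke_im_pos hz), cubeDefectQ_fricke hz, eta_mul_eta_pow_six_fricke hz]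
    have := eta_ne_zero' hz
    have := eta_ne_zero' (three_mul_im_pos hz)
    congr 1
    field_simp)
  have he := hc (qParam_mem_ball ellipticPoint_im_pos)
  have h0 := hc (qParam_mem_ball hz)
  rw [hFz _ ellipticPoint_im_pos, cubeDefectQ, ← etaLogP_eq, ← cubeSum_eq ellipticPoint_im_pos,
    etaLogP_ellipticPoint, cubeSum_ellipticPoint] at he
  simp only [Function.const_apply] at he h0
  rw [← he, hFz z hz, cubeDefectQ, ← etaLogP_eq, ← cubeSum_eq hz] at h0
  have : (6 / (Real.pi * I) * etaLogP z) ^ 3 - cubeSum z ^ 2 = 0 := by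
    simpa [eta_ne_zero' hz, eta_ne_zero' (three_mul_im_pos hz)] using h0
  linear_combination this

end EtaThree

/-! ### Power series with bounded coefficients -/

section PowerSeries

/-- The real function defined by a power series. -/
def powSum (a : ℕ → ℝ) (x : ℝ) : ℝ := ∑' k, a k * x ^ k

theorem summable_powSum {a : ℕ → ℝ} (ha : ∀ k, |a k| ≤ 1) {x : ℝ} (hx : |x| < 1) :
    Summable fun k ↦ a k * x ^ k :=
  .of_norm_bounded (summable_geometric_of_lt_one (abs_nonneg x) hx) fun k ↦ by
    rw [norm_mul, norm_pow, Real.norm_eq_abs, Real.norm_eq_abs]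
    exact mul_le_of_le_one_left (by positivity) (ha k)

theorem summable_powSum_deriv {a : ℕ → ℝ} (ha : ∀ k, |a k| ≤ 1) {x : ℝ} (hx : |x| < 1) :
    Summable fun k : ℕ ↦ a k * (k * x ^ (k - 1)) := by
  refine .of_norm_bounded (g := fun k : ℕ ↦ k * |x| ^ (k - 1)) ?_ fun k ↦ ?_
  · rw [← summable_nat_add_iff 1]
    have h0 := summable_pow_mul_geometric_of_norm_lt_one 1 (r := |x|) (by simpa using hx)
    have h1 := summable_geometric_of_lt_one (abs_nonneg x) hx
    refine (h0.add h1).congr fun k ↦ ?_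
    simp
    ring
  · rw [norm_mul, norm_mul, norm_pow, Real.norm_eq_abs, Real.norm_natCast, Real.norm_eq_abs]
    exact mul_le_of_le_one_left (by positivity) (ha k)

theorem hasDerivAt_powSum {a : ℕ → ℝ} (ha : ∀ k, |a k| ≤ 1) {x : ℝ} (hx : |x| < 1) :
    HasDerivAt (powSum a) (∑' k : ℕ, a k * (k * x ^ (k - 1))) x := by
  obtain ⟨r, hxr, hr⟩ := exists_between hx
  have hr0 : 0 < r := (abs_nonneg x).trans_lt hxr
  have hu : Summable fun k : ℕ ↦ (1 : ℝ) * (k * r ^ (k - 1)) :=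
    summable_powSum_deriv (a := fun _ ↦ 1) (by simp) (by rwa [abs_of_pos hr0])
  refine hasDerivAt_tsum_of_isPreconnected (t := Metric.ball 0 r) (y₀ := 0) hu Metric.isOpen_ball
    (convex_ball 0 r).isPreconnected
    (fun n y _ ↦ (hasDerivAt_pow n y).const_mul (a n)) (fun n y hy ↦ ?_) (by simpa using hr0)
    (summable_powSum ha (by simp)) (by simpa using hxr)
  rw [norm_mul, norm_mul, norm_pow, Real.norm_eq_abs, RCLike.norm_natCast]
  have : ‖y‖ ≤ r := by simpa using (mem_ball_zero_iff.mp hy).le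
  gcongr
  exact ha n

theorem hasDerivAt_powSum' {a : ℕ → ℝ} (ha : ∀ k, |a k| ≤ 1) {x : ℝ} (hx : |x| < 1) :
    HasDerivAt (powSum a) (∑' k : ℕ, a (k + 1) * ((k + 1) * x ^ k)) x := by
  convert! hasDerivAt_powSum ha hx using 1
  rw [(summable_powSum_deriv ha hx).tsum_eq_zero_add]
  simp

end PowerSeries

/-! ### The function `₂F₁(1/3, 2/3; 1; x)` and Euler's integral -/

namespace CubicHyp

/-- The coefficients of the hypergeometric series `₂F₁(1/3, 2/3; 1; x)`. -/
def coeff (k : ℕ) : ℝ :=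
  (ascPochhammer ℝ k).eval (1 / 3) * (ascPochhammer ℝ k).eval (2 / 3) / (k.factorial : ℝ) ^ 2

theorem coeff_zero : coeff 0 = 1 := by simp [coeff]

theorem coeff_pos (k : ℕ) : 0 < coeff k := by
  have h1 := ascPochhammer_pos k (1 / 3 : ℝ) (by norm_num)
  have h2 := ascPochhammer_pos k (2 / 3 : ℝ) (by norm_num)
  rw [coeff]
  positivity

theorem coeff_succ (k : ℕ) :
    (k + 1 : ℝ) ^ 2 * coeff (k + 1) = (k + 1 / 3) * (k + 2 / 3) * coeff k := by
  rw [coeff, coeff, ascPochhammer_succ_eval, ascPochhammer_succ_eval, Nat.factorial_succ]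
  push_cast
  field_simp
  ring

theorem coeff_le (k : ℕ) : coeff k ≤ 1 / (k + 1) := by
  induction k with
  | zero => simp [coeff_zero]
  | succ k ih =>
    have h := coeff_succ k
    rw [le_div_iff₀ (by positivity)] at ih ⊢
    push_cast
    have hp := coeff_pos k
    have h1 : (k + 1 : ℝ) ^ 2 * (coeff (k + 1) * (k + 1 + 1)) ≤ (k + 1 : ℝ) ^ 2 * 1 := by
      calc (k + 1 : ℝ) ^ 2 * (coeff (k + 1) * (k + 1 + 1))
          = (k + 1 / 3) * (k + 2 / 3) * (k + 2) * coeff k := by linear_combination (k + 2 : ℝ) * h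
        _ ≤ (k + 1) ^ 3 * coeff k := by
          gcongr
          have : (0 : ℝ) ≤ k := by positivity
          nlinarith
        _ = (k + 1) ^ 2 * (coeff k * (k + 1)) := by ring
        _ ≤ _ := by gcongr
    exact le_of_mul_le_mul_left h1 (by positivity)

theorem abs_coeff_le_one (k : ℕ) : |coeff k| ≤ 1 := by
  rw [abs_of_pos (coeff_pos k)]
  refine (coeff_le k).trans ?_
  rw [div_le_one (by positivity)]
  simp

/-- The function `₂F₁(1/3, 2/3; 1; x)`. -/
def hypF : ℝ → ℝ := powSum coeff

/-- The coefficients of `x (1 - x) F'(x)`, `F = ₂F₁(1/3, 2/3; 1; x)`. -/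
def coeffV : ℕ → ℝ
  | 0 => 0
  | k + 1 => 2 / 9 * coeff k / (k + 1)

theorem abs_coeffV_le_one (k : ℕ) : |coeffV k| ≤ 1 := by
  cases k with
  | zero => simp [coeffV]
  | succ k =>
    have h1 := coeff_pos k
    have h2 := abs_coeff_le_one k
    rw [abs_of_pos h1] at h2
    rw [coeffV, abs_of_pos (by positivity), div_le_one (by positivity)]
    have : (0 : ℝ) ≤ k := by positivity
    linarith

/-- The function `x (1 - x) F'(x)`, `F = ₂F₁(1/3, 2/3; 1; x)`. -/
def hypV : ℝ → ℝ := powSum coeffV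

theorem hypF_zero : hypF 0 = 1 := by
  rw [hypF, powSum, tsum_eq_single 0 fun k hk ↦ by simp [hk]]
  simp [coeff_zero]

theorem hypV_zero : hypV 0 = 0 := by
  rw [hypV, powSum, tsum_eq_single 0 fun k hk ↦ by simp [hk]]
  simp [coeffV]

theorem hasDerivAt_hypV {x : ℝ} (hx : |x| < 1) : HasDerivAt hypV (2 / 9 * hypF x) x := by
  convert! hasDerivAt_powSum' abs_coeffV_le_one hx using 1
  rw [hypF, powSum, ← tsum_mul_left]
  refine tsum_congr fun k ↦ ?_
  rw [coeffV]
  field_simp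

/-- With `hasDerivAt_hypV` this is the hypergeometric equation `(x(1-x)F')' = (2/9)F` as a
first-order system. On coefficients it says `(k+1) c_{k+1} - k c_k = (2/9) c_k / (k+1)`, since
`(k+1/3)(k+2/3) = k(k+1) + 2/9`. -/
theorem hasDerivAt_hypF {x : ℝ} (hx : |x| < 1) (hx0 : x ≠ 0) :
    HasDerivAt hypF (hypV x / (x * (1 - x))) x := by
  convert! hasDerivAt_powSum abs_coeff_le_one hx using 1
  have h1x : 1 - x ≠ 0 := by
    have := (abs_lt.mp hx).2
    linarith
  rw [div_eq_iff (mul_ne_zero hx0 h1x)]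
  have hs := summable_powSum_deriv abs_coeff_le_one hx
  have hs1 := hs.tsum_eq_zero_add
  have hs' := (summable_nat_add_iff 1).mpr hs
  set S := ∑' k : ℕ, coeff k * (k * x ^ (k - 1)) with hS
  have e1 : S * x = ∑' k : ℕ, coeff (k + 1) * ((k + 1) * x ^ (k + 1)) := by
    rw [hs1, Nat.cast_zero, zero_mul, mul_zero, zero_add, ← tsum_mul_right]
    refine tsum_congr fun k ↦ ?_
    rw [Nat.add_sub_cancel]
    push_cast
    ring
  have e2 : S * x ^ 2 = ∑' k : ℕ, coeff k * (k * x ^ (k + 1)) := by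
    rw [hS, ← tsum_mul_right]
    refine tsum_congr fun k ↦ ?_
    cases k with
    | zero => simp
    | succ k => rw [Nat.add_sub_cancel]; ring
  have s1 : Summable fun k : ℕ ↦ coeff (k + 1) * ((k + 1) * x ^ (k + 1)) := by
    refine (hs'.mul_right x).congr fun k ↦ ?_
    rw [Nat.add_sub_cancel]
    push_cast
    ring
  have s2 : Summable fun k : ℕ ↦ coeff k * (k * x ^ (k + 1)) := by
    refine (hs.mul_right (x ^ 2)).congr fun k ↦ ?_
    cases k with
    | zero => simp
    | succ k => rw [Nat.add_sub_cancel]; ring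
  rw [show S * (x * (1 - x)) = S * x - S * x ^ 2 by ring, e1, e2, ← s1.tsum_sub s2, hypV, powSum,
    (summable_powSum abs_coeffV_le_one hx).tsum_eq_zero_add]
  simp only [coeffV, zero_mul, zero_add]
  refine tsum_congr fun k ↦ ?_
  have h := coeff_succ k
  have hk : (k + 1 : ℝ) ≠ 0 := by positivity
  field_simp
  linear_combination (-9 : ℝ) * h

theorem hypF_pos {x : ℝ} (hx0 : 0 ≤ x) (hx : x < 1) : 0 < hypF x := by
  rw [hypF, powSum]
  have hs := summable_powSum abs_coeff_le_one (x := x) (by rwa [abs_of_nonneg hx0])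
  refine hs.tsum_pos (fun k ↦ ?_) 0 (by simp [coeff_zero])
  have := coeff_pos k
  positivity

open ProbabilityTheory

theorem threeFTwoTerm_eq (r : ℝ) (k : ℕ) : threeFTwoTerm (1 / 3) (2 / 3) r 1 1 1 k =
    coeff k * ((ascPochhammer ℝ k).eval r / k.factorial) := by
  rw [threeFTwoTerm, ascPochhammer_eval_one, coeff, one_pow]
  field_simp

theorem summable_threeFTwoTerm {r : ℝ} (hr0 : 0 < r) (hr1 : r < 1) :
    Summable (threeFTwoTerm (1 / 3) (2 / 3) r 1 1 1) := by
  set u : ℕ → ℝ := fun k ↦ (ascPochhammer ℝ k).eval r / k.factorial with hu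
  have hu0 : ∀ k, 0 < u k := fun k ↦ by
    have := ascPochhammer_pos k r hr0
    simp only [hu]
    positivity
  -- Since `coeff k ≤ 1/(k+1)`, it suffices to sum `u k / (k+1)`, which telescopes: `u k - u (k+1) =
  -- (1-r) u k / (k+1)`.
  have hsum : ∀ n, ∑ k ∈ Finset.range n, 1 / (k + 1 : ℝ) * u k = (u 0 - u n) / (1 - r) := by
    intro n
    have h1 : 1 - r ≠ 0 := by linarith
    induction n with
    | zero => simp
    | succ n ih =>
      rw [Finset.sum_range_succ, ih]
      have : u (n + 1) = u n * (r + n) / (n + 1) := by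
        simp only [hu]
        rw [ascPochhammer_succ_eval, Nat.factorial_succ]
        push_cast
        field_simp
      rw [this]
      field_simp
      ring
  have hS : Summable fun k : ℕ ↦ 1 / (k + 1 : ℝ) * u k := by
    refine summable_of_sum_range_le (c := u 0 / (1 - r)) (fun k ↦ ?_) fun n ↦ ?_
    · have := hu0 k
      positivity
    · rw [hsum]
      have := hu0 n
      have : 0 < 1 - r := by linarith
      gcongr
      linarith
  refine .of_nonneg_of_le (fun k ↦ ?_) (fun k ↦ ?_) hS <;> rw [threeFTwoTerm_eq]
  · exact (mul_pos (coeff_pos k) (hu0 k)).le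
  · exact mul_le_mul_of_nonneg_right (coeff_le k) (hu0 k).le

theorem gamma_add_nat {r : ℝ} (hr : 0 < r) (k : ℕ) :
    Real.Gamma (k + r) = (ascPochhammer ℝ k).eval r * Real.Gamma r := by
  induction k with
  | zero => simp
  | succ k ih =>
    rw [show ((k + 1 : ℕ) : ℝ) + r = (k + r) + 1 by push_cast; ring,
      Real.Gamma_add_one (by positivity), ih, ascPochhammer_succ_eval]
    ring

theorem beta_add_nat {r : ℝ} (hr0 : 0 < r) (k : ℕ) :
    beta (k + r) (1 - r) =
      beta r (1 - r) * ((ascPochhammer ℝ k).eval r / k.factorial) := by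
  rw [beta, beta, gamma_add_nat hr0, show (k : ℝ) + r + (1 - r) = k + 1 by ring,
    Real.Gamma_nat_eq_factorial, add_sub_cancel, Real.Gamma_one]
  ring

theorem integrableOn_beta_and_integral {a b : ℝ} (ha : 0 < a) (hb : 0 < b) :
    IntegrableOn (fun x : ℝ ↦ x ^ (a - 1) * (1 - x) ^ (b - 1)) (Ioo 0 1) ∧
      ∫ x in Ioo (0 : ℝ) 1, x ^ (a - 1) * (1 - x) ^ (b - 1) = beta a b := by
  have h := lintegral_betaPDF_eq_one ha hb
  rw [lintegral_betaPDF] at h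
  have hB := beta_pos ha hb
  have hval : ∫ x in Ioo (0 : ℝ) 1, 1 / beta a b * x ^ (a - 1) * (1 - x) ^ (b - 1) = 1 := by
    rw [integral_eq_lintegral_of_nonneg_ae, h, ENNReal.toReal_one]
    · refine ae_restrict_of_forall_mem measurableSet_Ioo fun x hx ↦ ?_
      have := hx.1
      have : 0 < 1 - x := by linarith [hx.2]
      simp only [Pi.zero_apply]
      positivity
    · exact Measurable.aestronglyMeasurable (by fun_prop)
  simp_rw [mul_assoc, integral_const_mul] at hval
  have hval' : ∫ x in Ioo (0 : ℝ) 1, x ^ (a - 1) * (1 - x) ^ (b - 1) = beta a b := by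
    field_simp at hval
    exact hval
  -- The integral of a non-integrable function is zero by convention, so a nonzero value proves
  -- integrability.
  exact ⟨.of_integral_ne_zero (by rw [hval']; exact hB.ne'), hval'⟩

theorem threeFTwo_pos {r : ℝ} (hr0 : 0 < r) (hr1 : r < 1) :
    0 < threeFTwo (1 / 3) (2 / 3) r 1 1 1 := by
  refine (summable_threeFTwoTerm hr0 hr1).tsum_pos (fun k ↦ ?_) 0 ?_
  · rw [threeFTwoTerm_eq]
    have := coeff_pos k
    have := ascPochhammer_pos k r hr0
    positivity
  · rw [threeFTwoTerm_eq]
    simp [coeff_zero]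

/-- Euler's integral for `₃F₂(1/3, 2/3, r; 1, 1; 1)`. -/
theorem integrableOn_hypF_and_integral {r : ℝ} (hr0 : 0 < r) (hr1 : r < 1) :
    IntegrableOn (fun x : ℝ ↦ hypF x * (x ^ (r - 1) * (1 - x) ^ (-r))) (Ioo 0 1) ∧
      ∫ x in Ioo (0 : ℝ) 1, hypF x * (x ^ (r - 1) * (1 - x) ^ (-r)) =
        beta r (1 - r) * threeFTwo (1 / 3) (2 / 3) r 1 1 1 := by
  set G : ℕ → ℝ → ℝ := fun k x ↦ coeff k * (x ^ ((k + r) - 1) * (1 - x) ^ ((1 - r) - 1)) with hG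
  have hb (k : ℕ) := integrableOn_beta_and_integral (a := k + r) (b := 1 - r) (by positivity)
    (by linarith)
  have hGi (k : ℕ) : IntegrableOn (G k) (Ioo 0 1) := (hb k).1.const_mul _
  have hGv (k : ℕ) : ∫ x in Ioo (0 : ℝ) 1, G k x =
      beta r (1 - r) * threeFTwoTerm (1 / 3) (2 / 3) r 1 1 1 k := by
    simp only [hG]
    rw [integral_const_mul, (hb k).2, beta_add_nat hr0, threeFTwoTerm_eq]
    ring
  have hGn (k : ℕ) : ∫ x in Ioo (0 : ℝ) 1, ‖G k x‖ = ∫ x in Ioo (0 : ℝ) 1, G k x := by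
    refine setIntegral_congr_fun measurableSet_Ioo fun x hx ↦ ?_
    have := coeff_pos k
    have := hx.1
    have : 0 < 1 - x := by linarith [hx.2]
    exact Real.norm_of_nonneg (by positivity)
  -- The terms are nonnegative, so the integrals of their norms are the terms of the convergent
  -- `₃F₂` series up to the Beta factor, and sum and integral may be exchanged.
  have hsum := hasSum_integral_of_summable_integral_norm (μ := volume.restrict (Ioo (0 : ℝ) 1))
    hGi (by simpa only [hGn, hGv] using (summable_threeFTwoTerm hr0 hr1).mul_left _)
  simp only [hGv] at hsum
  have hval := hsum.unique ((summable_threeFTwoTerm hr0 hr1).hasSum.mul_left (beta r (1 - r)))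
  have hcongr : ∫ x in Ioo (0 : ℝ) 1, ∑' k, G k x =
      ∫ x in Ioo (0 : ℝ) 1, hypF x * (x ^ (r - 1) * (1 - x) ^ (-r)) := by
    refine setIntegral_congr_fun measurableSet_Ioo fun x hx ↦ ?_
    simp only [hG, hypF, powSum]
    rw [← tsum_mul_right]
    refine tsum_congr fun k ↦ ?_
    rw [show (k + r - 1 : ℝ) = (r - 1) + k by ring, Real.rpow_add_natCast hx.1.ne',
      show 1 - r - 1 = -r by ring]
    ring
  rw [hcongr] at hval
  refine ⟨.of_integral_ne_zero ?_, hval⟩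
  change (∫ x in Ioo (0 : ℝ) 1, hypF x * (x ^ (r - 1) * (1 - x) ^ (-r))) ≠ 0
  rw [hval]
  exact (mul_pos (beta_pos hr0 (by linarith)) (threeFTwo_pos hr0 hr1)).ne'

end CubicHyp

/-! ### The cubic differential system and its solution by `₂F₁` -/

open Filter Topology

theorem eq_of_hasDerivAt_zero_of_tendsto {f : ℝ → ℝ} {l : ℝ}
    (hf : ∀ y, 0 < y → HasDerivAt f 0 y) (hl : Tendsto f atTop (𝓝 l)) {y : ℝ} (hy : 0 < y) :
    f y = l := by
  have hc : ∀ u ∈ Ioi (0 : ℝ), f u = f y := fun u hu ↦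
    isOpen_Ioi.is_const_of_deriv_eq_zero isPreconnected_Ioi
      (fun v hv ↦ (hf v hv).differentiableAt.differentiableWithinAt)
      (fun v hv ↦ (hf v hv).deriv) hu hy
  refine tendsto_nhds_unique (tendsto_const_nhds.congr' ?_) hl
  filter_upwards [Ioi_mem_atTop 0] with u hu using (hc u hu).symm

namespace CubicHyp

/-- The differential system satisfied by the cubes `b`, `c` of the cubic theta functions and by
their logarithmic derivatives, along the imaginary axis. -/
structure IsCubicSystem (b c P Q : ℝ → ℝ) : Prop where
  b_pos : ∀ y, 0 < y → 0 < b y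
  c_pos : ∀ y, 0 < y → 0 < c y
  b_deriv : ∀ y, 0 < y → HasDerivAt b (-Real.pi * (Q y - P y) * b y) y
  c_deriv : ∀ y, 0 < y → HasDerivAt c (-Real.pi * (Q y + P y) * c y) y
  Q_deriv : ∀ y, 0 < y → HasDerivAt Q (-(Real.pi / 3) * (Q y ^ 2 - P y ^ 2)) y
  P_cube : ∀ y, 0 < y → P y ^ 3 = (b y + c y) ^ 2
  b_tendsto : Tendsto b atTop (𝓝 1)
  c_tendsto : Tendsto c atTop (𝓝 0)
  Q_tendsto : Tendsto Q atTop (𝓝 1)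

namespace IsCubicSystem

variable {b c P Q : ℝ → ℝ} (h : IsCubicSystem b c P Q)

/-- The function `a` with `a ^ 3 = b + c`. -/
def cubeRoot (b c : ℝ → ℝ) (y : ℝ) : ℝ := (b y + c y) ^ (1 / 3 : ℝ)

/-- The modulus `c / (b + c)`. -/
def modulus (b c : ℝ → ℝ) (y : ℝ) : ℝ := c y / (b y + c y)

include h

theorem add_pos {y : ℝ} (hy : 0 < y) : 0 < b y + c y :=
  _root_.add_pos (h.b_pos y hy) (h.c_pos y hy)

theorem cubeRoot_pos {y : ℝ} (hy : 0 < y) : 0 < cubeRoot b c y :=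
  Real.rpow_pos_of_pos (h.add_pos hy) _

theorem cubeRoot_cube {y : ℝ} (hy : 0 < y) : cubeRoot b c y ^ 3 = b y + c y := by
  rw [cubeRoot, ← Real.rpow_natCast, ← Real.rpow_mul (h.add_pos hy).le]
  norm_num

theorem cubeRoot_sq {y : ℝ} (hy : 0 < y) : cubeRoot b c y ^ 2 = P y := by
  have h1 := h.P_cube y hy
  rw [← h.cubeRoot_cube hy] at h1
  have : Odd 3 := by decide
  exact (this.strictMono_pow (R := ℝ)).injective (by simp only [h1]; ring)

theorem hasDerivAt_cubeRoot {y : ℝ} (hy : 0 < y) : HasDerivAt (cubeRoot b c)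
    (-(Real.pi / 3) * (Q y * cubeRoot b c y + (c y - b y))) y := by
  convert! ((h.b_deriv y hy).add (h.c_deriv y hy)).rpow_const (p := 1 / 3)
    (Or.inl (h.add_pos hy).ne') using 1
  rw [Real.rpow_sub_one (by exact (h.add_pos hy).ne')]
  change _ = _ * (1 / 3) * (cubeRoot b c y / (b + c) y)
  have ha := h.cubeRoot_pos hy
  have h3 := h.cubeRoot_cube hy
  simp only [Pi.add_apply]
  rw [← h.cubeRoot_sq hy, ← h3]
  have hb : b y = cubeRoot b c y ^ 3 - c y := by linear_combination -h3
  rw [hb]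
  field_simp
  ring

theorem modulus_mem {y : ℝ} (hy : 0 < y) : modulus b c y ∈ Ioo (0 : ℝ) 1 := by
  have h1 := h.b_pos y hy
  have h2 := h.c_pos y hy
  refine ⟨by rw [modulus]; positivity, ?_⟩
  rw [modulus, div_lt_one (h.add_pos hy)]
  linarith

theorem one_sub_modulus {y : ℝ} (hy : 0 < y) : 1 - modulus b c y = b y / (b y + c y) := by
  have := (h.add_pos hy).ne'
  rw [modulus]
  field_simp
  ring

theorem hasDerivAt_modulus {y : ℝ} (hy : 0 < y) : HasDerivAt (modulus b c)
    (-(2 * Real.pi) * (cubeRoot b c y ^ 2 * (modulus b c y * (1 - modulus b c y)))) y := by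
  have hX := (h.add_pos hy).ne'
  convert! (h.c_deriv y hy).div ((h.b_deriv y hy).add (h.c_deriv y hy)) hX using 1
  rw [h.one_sub_modulus hy, h.cubeRoot_sq hy, modulus, Pi.add_apply]
  field_simp
  ring

/-- The derivative of `cubeRoot` with respect to the modulus, times `x (1 - x)`. -/
def theta (b c Q : ℝ → ℝ) (y : ℝ) : ℝ :=
  (Q y * cubeRoot b c y + (c y - b y)) / (6 * cubeRoot b c y ^ 2)

/-- Because `b c / a^3 = a^3 x(1-x)`, this reads `dθ/dx = (2/9) a`, the equation that `hypV`
satisfies with respect to `hypF`. -/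
theorem hasDerivAt_theta {y : ℝ} (hy : 0 < y) : HasDerivAt (theta b c Q)
    (-(2 * Real.pi) * (2 / 9 * (b y * c y / cubeRoot b c y ^ 3))) y := by
  have ha := h.cubeRoot_pos hy
  have h3 := h.cubeRoot_cube hy
  convert! (((h.Q_deriv y hy).mul (h.hasDerivAt_cubeRoot hy)).add
    ((h.c_deriv y hy).sub (h.b_deriv y hy))).div (((h.hasDerivAt_cubeRoot hy).pow 2).const_mul 6)
    (mul_ne_zero (by norm_num) (pow_ne_zero 2 ha.ne')) using 1
  have hb : b y = cubeRoot b c y ^ 3 - c y := by linear_combination -h3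
  simp only [Pi.add_apply, Pi.mul_apply, Pi.sub_apply, Pi.pow_apply]
  rw [← h.cubeRoot_sq hy, hb]
  field_simp
  ring

theorem cubeRoot_tendsto : Tendsto (cubeRoot b c) atTop (𝓝 1) := by
  have := (h.b_tendsto.add h.c_tendsto).rpow_const (p := 1 / 3) (Or.inl (by norm_num))
  rw [add_zero, Real.one_rpow] at this
  exact this

theorem modulus_tendsto : Tendsto (modulus b c) atTop (𝓝 0) := by
  have := h.c_tendsto.div (h.b_tendsto.add h.c_tendsto) (by norm_num)
  simpa using! this

theorem theta_tendsto : Tendsto (theta b c Q) atTop (𝓝 0) := by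
  have ha := h.cubeRoot_tendsto
  have := ((h.Q_tendsto.mul ha).add (h.c_tendsto.sub h.b_tendsto)).div
    ((ha.pow 2).const_mul 6) (by norm_num)
  simpa using! this

theorem hypF_modulus_tendsto : Tendsto (fun y ↦ hypF (modulus b c y)) atTop (𝓝 1) := by
  have h0 : ContinuousAt hypF 0 := (hasDerivAt_powSum abs_coeff_le_one (by simp)).continuousAt
  have := h0.tendsto.comp h.modulus_tendsto
  rwa [hypF_zero] at this

theorem hypV_modulus_tendsto : Tendsto (fun y ↦ hypV (modulus b c y)) atTop (𝓝 0) := by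
  have h0 : ContinuousAt hypV 0 := (hasDerivAt_hypV (by simp)).continuousAt
  have := h0.tendsto.comp h.modulus_tendsto
  rwa [hypV_zero] at this

theorem hasDerivAt_hypF_modulus {y : ℝ} (hy : 0 < y) :
    HasDerivAt (fun y ↦ hypF (modulus b c y))
      (-(2 * Real.pi) * (cubeRoot b c y ^ 2 * hypV (modulus b c y))) y := by
  have hm := h.modulus_mem hy
  convert! (hasDerivAt_hypF (by rw [abs_of_pos hm.1]; exact hm.2) hm.1.ne').comp y
    (h.hasDerivAt_modulus hy) using 1
  have := hm.1.ne'
  have : 1 - modulus b c y ≠ 0 := by linarith [hm.2]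
  field_simp

theorem hasDerivAt_hypV_modulus {y : ℝ} (hy : 0 < y) :
    HasDerivAt (fun y ↦ hypV (modulus b c y))
      (2 / 9 * hypF (modulus b c y) * (-(2 * Real.pi) *
        (cubeRoot b c y ^ 2 * (modulus b c y * (1 - modulus b c y))))) y := by
  have hm := h.modulus_mem hy
  exact (hasDerivAt_hypV (by rw [abs_of_pos hm.1]; exact hm.2)).comp y (h.hasDerivAt_modulus hy)

/-- The Wronskian of the solutions `(a, θ)` and `(F, V)` of one system is constant, and it tends to
`0` as `y → ∞`. Passing to the limit avoids a uniqueness theorem at the singular point `x = 0`. -/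
theorem theta_mul_hypF {y : ℝ} (hy : 0 < y) :
    theta b c Q y * hypF (modulus b c y) = cubeRoot b c y * hypV (modulus b c y) := by
  have hlim := (h.theta_tendsto.mul h.hypF_modulus_tendsto).sub
    (h.cubeRoot_tendsto.mul h.hypV_modulus_tendsto)
  have hd : ∀ y, 0 < y → HasDerivAt (fun y ↦ theta b c Q y * hypF (modulus b c y) -
      cubeRoot b c y * hypV (modulus b c y)) 0 y := by
    intro y hy
    convert! ((h.hasDerivAt_theta hy).mul (h.hasDerivAt_hypF_modulus hy)).sub
      ((h.hasDerivAt_cubeRoot hy).mul (h.hasDerivAt_hypV_modulus hy)) using 1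
    have ha := h.cubeRoot_pos hy
    have h3 := h.cubeRoot_cube hy
    rw [h.one_sub_modulus hy, theta, ← h3]
    generalize hypF (modulus b c y) = F
    generalize hypV (modulus b c y) = V
    rw [modulus, ← h3]
    field_simp
    ring
  have := eq_of_hasDerivAt_zero_of_tendsto hd hlim hy
  simp only [zero_mul, mul_zero, sub_zero] at this
  linarith

/-- The parametrisation of `₂F₁(1/3, 2/3; 1; x)` by `b` and `c`. -/
theorem cubeRoot_eq_hypF {y : ℝ} (hy : 0 < y) : cubeRoot b c y = hypF (modulus b c y) := by
  have hlim := h.cubeRoot_tendsto.div h.hypF_modulus_tendsto one_ne_zero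
  -- The numerator of the derivative of `a / F` is a multiple of the Wronskian `θ F - a V`, which
  -- vanishes.
  have hd : ∀ y, 0 < y → HasDerivAt (cubeRoot b c / fun y ↦ hypF (modulus b c y)) 0 y := by
    intro y hy
    have hm := h.modulus_mem hy
    have hF := hypF_pos hm.1.le hm.2
    convert! (h.hasDerivAt_cubeRoot hy).div (h.hasDerivAt_hypF_modulus hy) hF.ne' using 1
    have ha := h.cubeRoot_pos hy
    have ht := h.theta_mul_hypF hy
    rw [theta] at ht
    rw [eq_comm, div_eq_zero_iff]
    left
    field_simp at ht
    linear_combination (-Real.pi / 3) * ht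
  have := eq_of_hasDerivAt_zero_of_tendsto hd hlim hy
  have hm := h.modulus_mem hy
  have hF := hypF_pos hm.1.le hm.2
  rw [Pi.div_apply, div_one, div_eq_one_iff_eq hF.ne'] at this
  exact this

theorem strictAntiOn_modulus : StrictAntiOn (modulus b c) (Ioi 0) := by
  refine strictAntiOn_of_deriv_neg (convex_Ioi 0)
    (fun y hy ↦ (h.hasDerivAt_modulus hy).continuousAt.continuousWithinAt) fun y hy ↦ ?_
  rw [interior_Ioi] at hy
  rw [(h.hasDerivAt_modulus hy).deriv]
  have hm := h.modulus_mem hy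
  have := h.cubeRoot_pos hy
  have := hm.1
  have : 0 < 1 - modulus b c y := by linarith [hm.2]
  have := Real.pi_pos
  rw [neg_mul, neg_lt_zero]
  positivity

/-- The modulus tends to `0` at infinity; the symmetry `x ↦ 1 - x` then provides values close to
`1`, and continuity fills the interval. -/
theorem image_modulus (hs : ∀ y, 0 < y → ∃ u, 0 < u ∧ modulus b c u = 1 - modulus b c y) :
    modulus b c '' Ioi 0 = Ioo 0 1 := by
  have hsmall : ∀ v : ℝ, 0 < v → ∃ y, 0 < y ∧ modulus b c y < v := fun v hv ↦ by
    obtain ⟨y, hy1, hy2⟩ := ((h.modulus_tendsto.eventually (Iio_mem_nhds hv)).and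
      (Ioi_mem_atTop 0)).exists
    exact ⟨y, hy2, hy1⟩
  refine Subset.antisymm (image_subset_iff.mpr fun y hy ↦ h.modulus_mem hy) fun v hv ↦ ?_
  obtain ⟨y1, hy1, h1⟩ := hsmall v hv.1
  obtain ⟨y2, hy2, h2⟩ := hsmall (1 - v) (by linarith [hv.2])
  obtain ⟨y3, hy3, h3⟩ := hs y2 hy2
  exact isPreconnected_Ioi.intermediate_value (mem_Ioi.mpr hy1) (mem_Ioi.mpr hy3)
    (fun y hy ↦ (h.hasDerivAt_modulus hy).continuousAt.continuousWithinAt)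
    ⟨h1.le, by rw [h3]; linarith⟩

theorem integrableOn_and_integral
    (hs : ∀ y, 0 < y → ∃ u, 0 < u ∧ modulus b c u = 1 - modulus b c y)
    {r : ℝ} (hr0 : 0 < r) (hr1 : r < 1) :
    IntegrableOn (fun y ↦ c y ^ r * b y ^ (1 - r)) (Ioi 0) ∧
      ∫ y in Ioi 0, c y ^ r * b y ^ (1 - r) =
        1 / (2 * Real.pi) *
          (ProbabilityTheory.beta r (1 - r) * threeFTwo (1 / 3) (2 / 3) r 1 1 1) := by
  have hd : ∀ y ∈ Ioi (0 : ℝ), HasDerivWithinAt (modulus b c) _ (Ioi 0) y := fun y hy ↦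
    (h.hasDerivAt_modulus hy).hasDerivWithinAt
  have hi := h.strictAntiOn_modulus.injOn
  set g : ℝ → ℝ := fun x ↦ hypF x * (x ^ (r - 1) * (1 - x) ^ (-r)) with hg
  have hI := integrableOn_image_iff_integrableOn_abs_deriv_smul measurableSet_Ioi hd hi g
  have hV := integral_image_eq_integral_abs_deriv_smul measurableSet_Ioi hd hi g
  rw [h.image_modulus hs] at hI hV
  obtain ⟨e1, e2⟩ := integrableOn_hypF_and_integral hr0 hr1
  -- The Jacobian `2π a^2 x(1-x)` times `F(x) = a` gives `2π a^3 x^r (1-x)^(1-r)`, and `a^3 = b + c`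
  -- clears the denominators of `x` and `1 - x`.
  have hcong : EqOn (fun y ↦ |-(2 * Real.pi) * (cubeRoot b c y ^ 2 *
      (modulus b c y * (1 - modulus b c y)))| • g (modulus b c y))
      (fun y ↦ 2 * Real.pi * (c y ^ r * b y ^ (1 - r))) (Ioi 0) := by
    intro y hy
    have hm := h.modulus_mem hy
    have h1m : 0 < 1 - modulus b c y := by linarith [hm.2]
    have hm0 := hm.1
    have ha := h.cubeRoot_pos hy
    have hb := h.b_pos y hy
    have hc := h.c_pos y hy
    have hX := h.add_pos hy
    have := Real.pi_pos
    simp only [hg, smul_eq_mul]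
    rw [neg_mul, abs_neg, abs_of_pos (by positivity), ← h.cubeRoot_eq_hypF hy,
      Real.rpow_sub_one hm0.ne', Real.rpow_neg h1m.le]
    have e : (1 - modulus b c y) / (1 - modulus b c y) ^ r = (1 - modulus b c y) ^ (1 - r) := by
      rw [Real.rpow_sub h1m, Real.rpow_one]
    calc _ = 2 * Real.pi * (cubeRoot b c y ^ 3 * (modulus b c y ^ r *
          ((1 - modulus b c y) / (1 - modulus b c y) ^ r))) := by field_simp
      _ = _ := by
        rw [e, h.cubeRoot_cube hy, h.one_sub_modulus hy, modulus, Real.div_rpow hc.le hX.le,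
          Real.div_rpow hb.le hX.le, Real.rpow_sub hX, Real.rpow_one]
        field_simp
  rw [integrableOn_congr_fun hcong measurableSet_Ioi] at hI
  rw [setIntegral_congr_fun measurableSet_Ioi hcong, integral_const_mul, e2] at hV
  have hpi := Real.pi_pos
  refine ⟨?_, ?_⟩
  · have := (hI.mp e1).const_mul (1 / (2 * Real.pi))
    refine IntegrableOn.congr_fun this (fun y _ ↦ ?_) measurableSet_Ioi
    field_simp
  · rw [hV]
    field_simp

end IsCubicSystem

end CubicHyp

/-! ### The eta function on the imaginary axis -/

namespace EtaThree

open ModularForm Function.Periodic Filter Topology CubicHyp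

theorem I_mul_im_pos {y : ℝ} (hy : 0 < y) : 0 < (I * y : ℂ).im := by simpa using hy

theorem qParam_I_mul (y : ℝ) : qParam 1 (I * y) = (Real.exp (-2 * Real.pi * y) : ℝ) := by
  rw [qParam, ofReal_exp]
  congr 1
  push_cast
  linear_combination (2 * Real.pi * y : ℂ) * I_sq

/-- The eta function on the imaginary axis. -/
def etaI (y : ℝ) : ℝ := (η (I * y)).re

theorem exists_eta_I_mul {y : ℝ} (hy : 0 < y) : ∃ t : ℝ, 0 ≤ t ∧ η (I * y) = t := by
  set x : ℝ := Real.exp (-2 * Real.pi * y) with hx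
  have hx0 : 0 < x := Real.exp_pos _
  have hx1 : x < 1 := by
    rw [hx, Real.exp_lt_one_iff]
    have := Real.pi_pos
    nlinarith [mul_pos this hy]
  have hm : Multipliable fun n : ℕ ↦ 1 + -x ^ (n + 1) :=
    Real.multipliable_one_add_of_summable
      ((summable_nat_add_iff 1).mpr (summable_geometric_of_lt_one hx0.le hx1)).neg
  refine ⟨Real.exp (-2 * Real.pi * y / 24) * ∏' n : ℕ, (1 + -x ^ (n + 1)),
    mul_nonneg (Real.exp_pos _).le (tprod_nonneg fun n ↦ ?_), ?_⟩
  · linarith [pow_le_one₀ (n := n + 1) hx0.le hx1.le]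
  · have h := hm.map_tprod ofRealHom continuous_ofReal
    simp only [ofRealHom_eq_coe] at h
    have he : 2 * Real.pi * I * (I * y) / 24 = ((-2 * Real.pi * y / 24 : ℝ) : ℂ) := by
      push_cast
      linear_combination (2 * Real.pi * y / 24 : ℂ) * I_sq
    rw [eta_eq, ofReal_mul, h, euler, qParam_I_mul, he]
    refine congrArg₂ _ (ofReal_exp _).symm (tprod_congr fun n ↦ ?_)
    rw [hx]
    push_cast
    ring

theorem eta_I_mul {y : ℝ} (hy : 0 < y) : η (I * y) = etaI y := by
  obtain ⟨t, -, ht⟩ := exists_eta_I_mul hy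
  rw [etaI, ht, ofReal_re]

theorem etaI_pos {y : ℝ} (hy : 0 < y) : 0 < etaI y := by
  obtain ⟨t, h0, ht⟩ := exists_eta_I_mul hy
  have := eta_ne_zero' (I_mul_im_pos hy)
  rw [ht] at this
  rw [etaI, ht, ofReal_re]
  exact h0.lt_of_ne' (by simpa using this)

theorem three_mul_I_mul (y : ℝ) : (3 * (I * y) : ℂ) = I * (3 * y : ℝ) := by
  push_cast
  ring

theorem hasDerivAt_comp_I_mul {f : ℂ → ℂ} {f' : ℂ} {y : ℝ} (hf : HasDerivAt f f' (I * y)) :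
    HasDerivAt (fun w : ℂ ↦ f (I * w)) (I * f') (y : ℂ) := by
  have h1 : HasDerivAt (fun w : ℂ ↦ I * w) I (y : ℂ) := by
    simpa using (hasDerivAt_id (y : ℂ)).const_mul I
  rw [mul_comm]
  exact HasDerivAt.comp (y : ℂ) hf h1

/-- Minus the logarithmic derivative of the eta function on the imaginary axis. -/
def etaLogI (y : ℝ) : ℝ := (etaLog (I * y)).im

/-- Since `η` is real on the axis, `-I * η` has zero real part there; differentiating along the axis
shows that the real part of `etaLog` vanishes. -/
theorem etaLog_I_mul {y : ℝ} (hy : 0 < y) : etaLog (I * y) = I * etaLogI y := by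
  have h1 := ((hasDerivAt_comp_I_mul (hasDerivAt_eta (I_mul_im_pos hy))).const_mul
    (-I)).real_of_complex
  have h2 : (fun x : ℝ ↦ (-I * η (I * x)).re) =ᶠ[𝓝 y] fun _ ↦ 0 := by
    filter_upwards [Ioi_mem_nhds hy] with x hx
    rw [eta_I_mul hx]
    simp
  have h3 := h1.unique ((hasDerivAt_const y (0 : ℝ)).congr_of_eventuallyEq h2)
  rw [eta_I_mul hy, show -I * (I * (etaLog (I * y) * etaI y)) = etaLog (I * y) * etaI y by
    linear_combination (-(etaLog (I * y) * etaI y)) * I_sq, re_mul_ofReal] at h3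
  have h4 := (mul_eq_zero.mp h3).resolve_right (etaI_pos hy).ne'
  apply Complex.ext <;> simp [etaLogI, h4]

theorem hasDerivAt_etaI {y : ℝ} (hy : 0 < y) :
    HasDerivAt etaI (-etaLogI y * etaI y) y := by
  have h1 := (hasDerivAt_comp_I_mul (hasDerivAt_eta (I_mul_im_pos hy))).real_of_complex
  rw [eta_I_mul hy, etaLog_I_mul hy, show I * (I * (etaLogI y : ℂ) * etaI y) =
    ((-etaLogI y * etaI y : ℝ) : ℂ) by
      push_cast; linear_combination (etaLogI y * etaI y : ℂ) * I_sq, ofReal_re] at h1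
  exact h1

theorem hasDerivAt_etaI_three {y : ℝ} (hy : 0 < y) :
    HasDerivAt (fun y ↦ etaI (3 * y)) (-(3 * etaLogI (3 * y)) * etaI (3 * y)) y := by
  have h1 : HasDerivAt (fun y : ℝ ↦ 3 * y) 3 y := by simpa using (hasDerivAt_id y).const_mul 3
  convert! (hasDerivAt_etaI (y := 3 * y) (by positivity)).comp y h1 using 1
  ring

/-- The cube of the cubic theta function `b` on the imaginary axis. -/
def cubeB (y : ℝ) : ℝ := etaI y ^ 9 / etaI (3 * y) ^ 3

/-- The cube of the cubic theta function `c` on the imaginary axis. -/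
def cubeC (y : ℝ) : ℝ := 27 * (etaI (3 * y) ^ 9 / etaI y ^ 3)

/-- The Eisenstein series `(3 E₂(3z) - E₂(z)) / 2` on the imaginary axis. -/
def eisP (y : ℝ) : ℝ := 6 / Real.pi * (3 * etaLogI (3 * y) - etaLogI y)

/-- The quasimodular form `(3 E₂(3z) + E₂(z)) / 4` on the imaginary axis. -/
def eisQ (y : ℝ) : ℝ := 3 / Real.pi * (3 * etaLogI (3 * y) + etaLogI y)

theorem etaLogP_I_mul {y : ℝ} (hy : 0 < y) : etaLogP (I * y) = I * (Real.pi / 6 * eisP y : ℝ) := by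
  have := ofReal_ne_zero.mpr Real.pi_ne_zero
  rw [etaLogP, three_mul_I_mul, etaLog_I_mul hy, etaLog_I_mul (by positivity), eisP]
  push_cast
  field_simp

theorem etaLogS_I_mul {y : ℝ} (hy : 0 < y) : etaLogS (I * y) = I * (Real.pi / 3 * eisQ y : ℝ) := by
  have := ofReal_ne_zero.mpr Real.pi_ne_zero
  rw [etaLogS, three_mul_I_mul, etaLog_I_mul hy, etaLog_I_mul (by positivity), eisQ]
  push_cast
  field_simp

theorem cubeSum_I_mul {y : ℝ} (hy : 0 < y) : cubeSum (I * y) = (cubeB y + cubeC y : ℝ) := by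
  rw [cubeSum, three_mul_I_mul, eta_I_mul hy, eta_I_mul (by positivity), cubeB, cubeC]
  push_cast
  rfl

theorem eisP_cube {y : ℝ} (hy : 0 < y) : eisP y ^ 3 = (cubeB y + cubeC y) ^ 2 := by
  have h := etaLogP_cube (I_mul_im_pos hy)
  rw [etaLogP_I_mul hy, cubeSum_I_mul hy] at h
  have h1 : 6 / (Real.pi * I) * (I * ((Real.pi / 6 * eisP y : ℝ) : ℂ)) = (eisP y : ℂ) := by
    have := ofReal_ne_zero.mpr Real.pi_ne_zero
    have := I_ne_zero
    push_cast
    field_simp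
  rw [h1] at h
  exact_mod_cast h

theorem hasDerivAt_eisQ {y : ℝ} (hy : 0 < y) :
    HasDerivAt eisQ (-(Real.pi / 3) * (eisQ y ^ 2 - eisP y ^ 2)) y := by
  have hpi := Real.pi_ne_zero
  have h1 := ((hasDerivAt_comp_I_mul (hasDerivAt_etaLogS' (I_mul_im_pos hy))).const_mul
    (-I * (3 / Real.pi : ℝ))).real_of_complex
  have h2 : (fun x : ℝ ↦ (-I * (3 / Real.pi : ℝ) * etaLogS (I * x)).re) =ᶠ[𝓝 y] eisQ := by
    filter_upwards [Ioi_mem_nhds hy] with x hx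
    rw [etaLogS_I_mul hx, show -I * ((3 / Real.pi : ℝ) : ℂ) * (I * ((Real.pi / 3 * eisQ x : ℝ) : ℂ))
      = ((3 / Real.pi * (Real.pi / 3 * eisQ x) : ℝ) : ℂ) by
        push_cast
        linear_combination (-(3 / Real.pi * (Real.pi / 3 * eisQ x)) : ℂ) * I_sq, ofReal_re]
    field_simp
  convert! h1.congr_of_eventuallyEq h2.symm using 1
  rw [etaLogS_I_mul hy, etaLogP_I_mul hy,
    show -I * ((3 / Real.pi : ℝ) : ℂ) * (I * ((I * ((Real.pi / 3 * eisQ y : ℝ) : ℂ)) ^ 2 -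
      4 * (I * ((Real.pi / 6 * eisP y : ℝ) : ℂ)) ^ 2)) =
      ((-(3 / Real.pi * ((Real.pi / 3 * eisQ y) ^ 2 - 4 * (Real.pi / 6 * eisP y) ^ 2)) : ℝ) : ℂ) by
    have : I ^ 4 = 1 := I_pow_four
    push_cast
    linear_combination (-(3 / Real.pi * ((Real.pi / 3 * eisQ y) ^ 2 -
      4 * (Real.pi / 6 * eisP y) ^ 2)) : ℂ) * this, ofReal_re]
  field_simp
  ring

theorem cubeB_pos {y : ℝ} (hy : 0 < y) : 0 < cubeB y := by
  have := etaI_pos hy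
  have := etaI_pos (y := 3 * y) (by positivity)
  rw [cubeB]
  positivity

theorem cubeC_pos {y : ℝ} (hy : 0 < y) : 0 < cubeC y := by
  have := etaI_pos hy
  have := etaI_pos (y := 3 * y) (by positivity)
  rw [cubeC]
  positivity

theorem hasDerivAt_cubeB {y : ℝ} (hy : 0 < y) :
    HasDerivAt cubeB (-Real.pi * (eisQ y - eisP y) * cubeB y) y := by
  have h1 := etaI_pos hy
  have h3 := etaI_pos (y := 3 * y) (by positivity)
  have := Real.pi_ne_zero
  convert! ((hasDerivAt_etaI hy).pow 9).div ((hasDerivAt_etaI_three hy).pow 3)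
    (pow_ne_zero 3 h3.ne') using 1
  simp only [Pi.pow_apply, eisQ, eisP, cubeB]
  field_simp
  ring

theorem hasDerivAt_cubeC {y : ℝ} (hy : 0 < y) :
    HasDerivAt cubeC (-Real.pi * (eisQ y + eisP y) * cubeC y) y := by
  have h1 := etaI_pos hy
  have h3 := etaI_pos (y := 3 * y) (by positivity)
  have := Real.pi_ne_zero
  convert! (((hasDerivAt_etaI_three hy).pow 9).div ((hasDerivAt_etaI hy).pow 3)
    (pow_ne_zero 3 h1.ne')).const_mul 27 using 1
  simp only [Pi.pow_apply, eisQ, eisP, cubeC]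
  field_simp
  ring

theorem tendsto_qParam_I_mul : Tendsto (fun y : ℝ ↦ qParam 1 (I * y)) atTop (𝓝 0) := by
  simp_rw [qParam_I_mul]
  have h : Tendsto (fun y : ℝ ↦ Real.exp (-2 * Real.pi * y)) atTop (𝓝 0) :=
    Real.tendsto_exp_atBot.comp
      (tendsto_id.const_mul_atTop_of_neg (by have := Real.pi_pos; linarith))
  have := (continuous_ofReal.tendsto 0).comp h
  rwa [ofReal_zero] at this

theorem tendsto_comp_qParam {F : ℂ → ℂ} (hF : DifferentiableOn ℂ F (Metric.ball 0 1)) :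
    Tendsto (fun y : ℝ ↦ F (qParam 1 (I * y))) atTop (𝓝 (F 0)) :=
  (hF.differentiableAt (Metric.isOpen_ball.mem_nhds zero_mem_ball)).continuousAt.tendsto.comp
    tendsto_qParam_I_mul

theorem differentiableOn_cubeBQ :
    DifferentiableOn ℂ (fun q ↦ euler q ^ 9 / euler (q ^ 3) ^ 3) (Metric.ball 0 1) :=
  (differentiableOn_euler.pow 9).div
    ((differentiableOn_comp_pow_three differentiableOn_euler).pow 3) fun _ hq ↦
    pow_ne_zero _ (euler_ne_zero (mapsTo_pow_three hq))

theorem eta_div_eta (z : ℂ) :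
    η z ^ 9 / η (3 * z) ^ 3 = euler (qParam 1 z) ^ 9 / euler (qParam 1 z ^ 3) ^ 3 := by
  rw [eta_eq, eta_eq, qParam_three_mul, mul_pow, mul_pow, ← Complex.exp_nat_mul,
    ← Complex.exp_nat_mul, show ((9 : ℕ) : ℂ) * (2 * Real.pi * I * z / 24) =
      (3 : ℕ) * (2 * Real.pi * I * (3 * z) / 24) by push_cast; ring,
    mul_div_mul_left _ _ (Complex.exp_ne_zero _)]

theorem tendsto_cubeB : Tendsto cubeB atTop (𝓝 1) := by
  have h := (continuous_re.tendsto _).comp (tendsto_comp_qParam differentiableOn_cubeBQ)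
  simp only [ne_eq, OfNat.ofNat_ne_zero, not_false_eq_true, zero_pow, euler_zero, one_pow, div_one,
    one_re] at h
  refine h.congr' ?_
  filter_upwards [Ioi_mem_atTop 0] with y hy
  have hy : 0 < y := hy
  rw [Function.comp_apply, ← eta_div_eta, three_mul_I_mul, eta_I_mul hy,
    eta_I_mul (by positivity), cubeB]
  norm_cast

theorem tendsto_cubeC : Tendsto cubeC atTop (𝓝 0) := by
  have h := ((continuous_re.tendsto _).comp
    (tendsto_comp_qParam differentiableOn_cubeSumQ)).sub tendsto_cubeB
  have h0 : (cubeSumQ 0).re - 1 = 0 := by simp [cubeSumQ, euler_zero]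
  rw [h0] at h
  refine h.congr' ?_
  filter_upwards [Ioi_mem_atTop 0] with y hy
  rw [Function.comp_apply, ← cubeSum_eq (I_mul_im_pos hy), cubeSum_I_mul hy, ofReal_re]
  ring

theorem tendsto_eisQ : Tendsto eisQ atTop (𝓝 1) := by
  have hpi := Real.pi_ne_zero
  have h := ((continuous_im.tendsto _).comp
    (tendsto_comp_qParam differentiableOn_etaLogSQ)).const_mul (3 / Real.pi)
  have h0 : 3 / Real.pi * (etaLogSQ 0).im = 1 := by
    simp [etaLogSQ, etaLogQ_zero]
  rw [h0] at h
  refine h.congr' ?_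
  filter_upwards [Ioi_mem_atTop 0] with y hy
  rw [Function.comp_apply, ← etaLogS_eq, etaLogS_I_mul hy, I_mul_im, ofReal_re]
  field_simp

theorem isCubicSystem : IsCubicSystem cubeB cubeC eisP eisQ where
  b_pos _ := cubeB_pos
  c_pos _ := cubeC_pos
  b_deriv _ := hasDerivAt_cubeB
  c_deriv _ := hasDerivAt_cubeC
  Q_deriv _ := hasDerivAt_eisQ
  P_cube _ := eisP_cube
  b_tendsto := tendsto_cubeB
  c_tendsto := tendsto_cubeC
  Q_tendsto := tendsto_eisQ

/-- The ratio `x/(1-x) = c/b = 27 (η(3τ)/η(τ))^12` is inverted by the Fricke involution, which acts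
as `y ↦ 1/(3y)`. -/
theorem modulus_fricke {y : ℝ} (hy : 0 < y) :
    ∃ u, 0 < u ∧ IsCubicSystem.modulus cubeB cubeC u =
      1 - IsCubicSystem.modulus cubeB cubeC y := by
  have hu : 0 < 1 / (3 * y) := by positivity
  refine ⟨1 / (3 * y), hu, ?_⟩
  have hz := I_mul_im_pos hy
  have hW : -1 / (3 * (I * y)) = I * (1 / (3 * y) : ℝ) := by
    have := ofReal_ne_zero.mpr hy.ne'
    have := I_ne_zero
    push_cast
    field_simp
    exact I_sq.symm
  have e1 := eta_fricke hz
  have e3 := eta_three_fricke hz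
  rw [hW, three_mul_I_mul, eta_I_mul hu, eta_I_mul (by positivity)] at e1
  rw [hW, three_mul_I_mul, eta_I_mul (by positivity), eta_I_mul hy] at e3
  have p1 := etaI_pos hy
  have p3 := etaI_pos (y := 3 * y) (by positivity)
  have p1' := etaI_pos hu
  have p3' := etaI_pos (y := 3 * (1 / (3 * y))) (by positivity)
  have hr : etaI (1 / (3 * y)) * etaI y = √3 * etaI (3 * y) * etaI (3 * (1 / (3 * y))) := by
    have : (etaI (1 / (3 * y)) : ℂ) * etaI y =
        (√3 : ℝ) * etaI (3 * y) * etaI (3 * (1 / (3 * y))) := by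
      rw [e1, e3]
      ring
    exact_mod_cast this
  rw [isCubicSystem.one_sub_modulus hy, IsCubicSystem.modulus,
    div_eq_div_iff (isCubicSystem.add_pos hu).ne' (isCubicSystem.add_pos hy).ne']
  simp only [cubeB, cubeC]
  generalize etaI (3 * (1 / (3 * y))) = u3 at *
  generalize etaI (1 / (3 * y)) = u1 at *
  generalize etaI (3 * y) = v3 at *
  generalize etaI y = v1 at *
  have h12 : (u1 * v1) ^ 12 = 729 * (v3 * u3) ^ 12 := by
    rw [hr, show (√3 * v3 * u3) ^ 12 = (√3 ^ 2) ^ 6 * (v3 * u3) ^ 12 by ring,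
      Real.sq_sqrt (by norm_num)]
    norm_num
  field_simp
  linear_combination (-1 : ℝ) * h12

/-! ### Integrals and `L`-values of the eta-quotients -/

/-- The function `𝕂₃(j/12, 1)` on the imaginary axis. -/
def kThreeI (j : ℤ) (y : ℝ) : ℝ := etaI y ^ (9 - j) * etaI (3 * y) ^ (j - 3)

theorem kThree_I_mul (j : ℤ) {y : ℝ} (hy : 0 < y) : kThree j (I * y) = kThreeI j y := by
  rw [kThree, three_mul_I_mul, eta_I_mul hy, eta_I_mul (by positivity), kThreeI]
  push_cast
  rfl

theorem cubeC_rpow_mul_cubeB_rpow (j : ℤ) {y : ℝ} (hy : 0 < y) :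
    cubeC y ^ (j / 12 : ℝ) * cubeB y ^ (1 - j / 12 : ℝ) =
      27 ^ (j / 12 : ℝ) * kThreeI j y := by
  have p1 := etaI_pos hy
  have p3 := etaI_pos (y := 3 * y) (by positivity)
  rw [cubeB, cubeC, kThreeI]
  generalize etaI (3 * y) = v3 at *
  generalize etaI y = v1 at *
  rw [Real.mul_rpow (by norm_num) (by positivity), Real.div_rpow (by positivity) (by positivity),
    Real.div_rpow (by positivity) (by positivity), ← Real.rpow_natCast, ← Real.rpow_natCast,
    ← Real.rpow_natCast, ← Real.rpow_natCast, ← Real.rpow_mul p1.le, ← Real.rpow_mul p1.le,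
    ← Real.rpow_mul p3.le, ← Real.rpow_mul p3.le, ← Real.rpow_intCast, ← Real.rpow_intCast,
    show (((9 - j : ℤ) : ℤ) : ℝ) = ((9 : ℕ) : ℝ) * (1 - j / 12) - ((3 : ℕ) : ℝ) * (j / 12) by
      push_cast; ring,
    show (((j - 3 : ℤ) : ℤ) : ℝ) = ((9 : ℕ) : ℝ) * (j / 12) - ((3 : ℕ) : ℝ) * (1 - j / 12) by
      push_cast; ring, Real.rpow_sub p1, Real.rpow_sub p3]
  ring

theorem kThreeI_integral {j : ℤ} (h0 : 0 < j) (h12 : j < 12) :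
    IntegrableOn (kThreeI j) (Ioi 0) ∧
      ∫ y in Ioi 0, kThreeI j y =
        (27 ^ (j / 12 : ℝ))⁻¹ * (√3 / (4 * Real.pi ^ 2)) * threePTwo (j / 12) := by
  have h0' : (0 : ℝ) < j / 12 := by
    have : (0 : ℝ) < j := by exact_mod_cast h0
    positivity
  have h1' : (j / 12 : ℝ) < 1 := by
    have : (j : ℝ) < 12 := by exact_mod_cast h12
    linarith
  obtain ⟨e1, e2⟩ := isCubicSystem.integrableOn_and_integral (fun _ ↦ modulus_fricke) h0' h1'
  have hc : EqOn (fun y ↦ cubeC y ^ (j / 12 : ℝ) * cubeB y ^ (1 - j / 12 : ℝ))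
      (fun y ↦ 27 ^ (j / 12 : ℝ) * kThreeI j y) (Ioi 0) :=
    fun y hy ↦ cubeC_rpow_mul_cubeB_rpow j hy
  have h27 : (0 : ℝ) < 27 ^ (j / 12 : ℝ) := by positivity
  rw [integrableOn_congr_fun hc measurableSet_Ioi] at e1
  rw [setIntegral_congr_fun measurableSet_Ioi hc, integral_const_mul] at e2
  refine ⟨?_, ?_⟩
  · have := e1.const_mul (27 ^ (j / 12 : ℝ))⁻¹
    refine IntegrableOn.congr_fun this (fun y _ ↦ ?_) measurableSet_Ioi
    field_simp
  · have hpi := Real.pi_pos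
    have h3 : √3 ^ 2 = 3 := Real.sq_sqrt (by norm_num)
    rw [eq_comm, mul_assoc, inv_mul_eq_iff_eq_mul₀ h27.ne', e2, threePTwo]
    field_simp
    rw [h3]
    ring

/-- The fourth root of three. -/
def fourthRootThree : ℝ := 3 ^ (1 / 4 : ℝ)

theorem fourthRootThree_pos : 0 < fourthRootThree := by
  rw [fourthRootThree]
  positivity

theorem rpow_eq_fourthRootThree_pow (n : ℕ) : (3 : ℝ) ^ (n / 4 : ℝ) = fourthRootThree ^ n := by
  rw [fourthRootThree, ← Real.rpow_natCast, ← Real.rpow_mul (by norm_num)]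
  congr 1
  ring

theorem fourthRootThree_pow_four : fourthRootThree ^ 4 = 3 := by
  rw [← rpow_eq_fourthRootThree_pow]
  norm_num

theorem sqrt_three_eq : √3 = fourthRootThree ^ 2 := by
  rw [← rpow_eq_fourthRootThree_pow, Real.sqrt_eq_rpow]
  norm_num

/-- With this every constant involving `3` becomes a natural power of `t = 3^(1/4)`, so the final
identities are algebra modulo `t^4 = 3`. -/
theorem twentySeven_rpow (j : ℕ) : (27 : ℝ) ^ (j / 12 : ℝ) = fourthRootThree ^ j := by
  rw [← rpow_eq_fourthRootThree_pow, show (27 : ℝ) = 3 ^ (3 : ℝ) by norm_num,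
    ← Real.rpow_mul (by norm_num)]
  congr 1
  ring

theorem kThree_mul_I_mul (j : ℤ) (N : ℕ) [NeZero N] {y : ℝ} (hy : 0 < y) :
    kThree j (N * (I * y)) = kThreeI j (N * y) := by
  have : 0 < (N : ℝ) := by exact_mod_cast NeZero.pos N
  rw [← kThree_I_mul j (by positivity)]
  congr 1
  push_cast
  ring

theorem kThree_converges {j : ℤ} (h0 : 0 < j) (h12 : j < 12) (N : ℕ) [NeZero N] :
    LValueOneConverges fun τ ↦ kThree j (N * τ) := by
  have hN : 0 < (N : ℝ) := by exact_mod_cast NeZero.pos N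
  have h1 := (integrableOn_Ioi_comp_mul_left_iff (kThreeI j) 0 hN).mpr
    (by simpa using (kThreeI_integral h0 h12).1)
  refine IntegrableOn.congr_fun (h1.ofReal.mul_const I) (fun y hy ↦ ?_) measurableSet_Ioi
  simp only [kThree_mul_I_mul j N hy]
  rfl

theorem lValueOne_kThree {j : ℕ} (h0 : 0 < j) (h12 : j < 12) (N : ℕ) [NeZero N] :
    lValueOne (fun τ ↦ kThree j (N * τ)) =
      fourthRootThree ^ 2 / (2 * Real.pi * N * fourthRootThree ^ j) * threePTwo (j / 12) := by
  have hN : 0 < (N : ℝ) := by exact_mod_cast NeZero.pos N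
  have h1 : ∫ y in Ioi (0 : ℝ), kThree j (N * (I * y)) * I =
      ((∫ y in Ioi (0 : ℝ), kThreeI j (N * y) : ℝ) : ℂ) * I := by
    rw [← integral_complex_ofReal, ← integral_mul_const]
    exact setIntegral_congr_fun measurableSet_Ioi fun y hy ↦ by simp only [kThree_mul_I_mul j N hy]
  rw [lValueOne, h1, integral_comp_mul_left_Ioi (kThreeI j) 0 hN, mul_zero,
    (kThreeI_integral (j := j) (by exact_mod_cast h0) (by exact_mod_cast h12)).2, Int.cast_natCast,
    twentySeven_rpow, sqrt_three_eq]
  have ht := ofReal_ne_zero.mpr fourthRootThree_pos.ne'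
  have hpi := ofReal_ne_zero.mpr Real.pi_ne_zero
  have hN' : (N : ℂ) ≠ 0 := by exact_mod_cast hN.ne'
  simp only [smul_eq_mul]
  push_cast
  field_simp
  rw [I_sq]
  ring

/-- For `j = 3` and `j = 9` the quotients are `η(τ)^6` and `η(3τ)^6`, so their integrals differ by
the factor `3` of the rescaling `y ↦ 3y`. -/
theorem threePTwo_one_quarter :
    threePTwo (1 / 4) = 1 / fourthRootThree ^ 2 * threePTwo (3 / 4) := by
  have h : ∫ y in Ioi 0, kThreeI 9 y = 3⁻¹ * ∫ y in Ioi 0, kThreeI 3 y := by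
    have := integral_comp_mul_left_Ioi (kThreeI 3) 0 (b := 3) (by norm_num)
    rw [mul_zero, smul_eq_mul] at this
    rw [← this]
    exact setIntegral_congr_fun measurableSet_Ioi fun y _ ↦ by simp [kThreeI]
  have e9 := twentySeven_rpow 9
  have e3 := twentySeven_rpow 3
  rw [(kThreeI_integral (j := 9) (by norm_num) (by norm_num)).2,
    (kThreeI_integral (j := 3) (by norm_num) (by norm_num)).2] at h
  push_cast at h e9 e3
  rw [e9, e3, show (9 / 12 : ℝ) = 3 / 4 by norm_num, show (3 / 12 : ℝ) = 1 / 4 by norm_num] at h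
  have := fourthRootThree_pos
  have := Real.pi_pos
  have h4 := fourthRootThree_pow_four
  field_simp at h ⊢
  rw [show fourthRootThree ^ 6 = fourthRootThree ^ 4 * fourthRootThree ^ 2 by ring, h4] at h
  linear_combination -h / 3

end EtaThree

/-! ### Linearity of the `L`-value -/

section LValue

variable {f g : ℂ → ℂ}

theorem LValueOneConverges.add (hf : LValueOneConverges f) (hg : LValueOneConverges g) :
    LValueOneConverges fun τ ↦ f τ + g τ := by
  refine (Integrable.add hf hg).congr (.of_forall fun y ↦ ?_)
  simp [add_mul]

theorem LValueOneConverges.sub (hf : LValueOneConverges f) (hg : LValueOneConverges g) :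
    LValueOneConverges fun τ ↦ f τ - g τ := by
  refine (Integrable.sub hf hg).congr (.of_forall fun y ↦ ?_)
  simp [sub_mul]

theorem LValueOneConverges.const_mul (c : ℂ) (hf : LValueOneConverges f) :
    LValueOneConverges fun τ ↦ c * f τ := by
  refine (Integrable.const_mul hf c).congr (.of_forall fun y ↦ ?_)
  simp [mul_assoc]

theorem lValueOne_add (hf : LValueOneConverges f) (hg : LValueOneConverges g) :
    lValueOne (fun τ ↦ f τ + g τ) = lValueOne f + lValueOne g := by
  simp only [lValueOne, add_mul]
  rw [integral_add hf hg, mul_add]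

theorem lValueOne_sub (hf : LValueOneConverges f) (hg : LValueOneConverges g) :
    lValueOne (fun τ ↦ f τ - g τ) = lValueOne f - lValueOne g := by
  simp only [lValueOne, sub_mul]
  rw [integral_sub hf hg, mul_sub]

theorem lValueOne_const_mul (c : ℂ) : lValueOne (fun τ ↦ c * f τ) = c * lValueOne f := by
  simp only [lValueOne, mul_assoc]
  rw [integral_const_mul]
  ring

end LValue

end

/-! ### The five evaluations -/

open EtaThree in
theorem corollary5p3 :
    -- the hypergeometric series at `1` and the integrals that define the `L`-values converge
    (∀ j : ℕ, 1 ≤ j → j ≤ 11 →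
      Summable (threeFTwoTerm (1 / 3) (2 / 3) ((j : ℝ) / 12) 1 1 1)) ∧
    (LValueOneConverges f_12_3_c_a ∧ LValueOneConverges f_27_3_b_b ∧
      LValueOneConverges f_16_3_c_a ∧ LValueOneConverges f_108_3_c_b ∧
      LValueOneConverges f_432_3_g_e) ∧
    -- the five evaluations
    12 * (Real.pi : ℂ) * lValueOne f_12_3_c_a = (threePTwo (1 / 2) : ℂ) ∧
    2 * ((3 : ℝ) ^ (3 / 2 : ℝ) : ℝ) * (Real.pi : ℂ) * lValueOne f_27_3_b_b
      = (threePTwo (1 / 3) : ℂ) + I * (threePTwo (2 / 3) : ℂ) ∧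
    (8 * ((3 : ℝ) ^ (1 / 4 : ℝ) : ℝ) * (Real.pi : ℂ) * lValueOne f_16_3_c_a
        = (threePTwo (1 / 4) : ℂ) ∧
      threePTwo (1 / 4) = 1 / √3 * threePTwo (3 / 4)) ∧
    12 * (Real.pi : ℂ) * lValueOne f_108_3_c_b
      = (threePTwo (1 / 6) : ℂ) + I * (threePTwo (5 / 6) : ℂ) ∧
    8 * ((3 : ℝ) ^ (5 / 4 : ℝ) : ℝ) * (Real.pi : ℂ) * lValueOne f_432_3_g_e
      = (√3 : ℝ) * ((threePTwo (1 / 12) : ℂ) + (√5 : ℝ) * (threePTwo (5 / 12) : ℂ))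
        - I * (√3 : ℝ) * ((√5 : ℝ) * (threePTwo (7 / 12) : ℂ) + (threePTwo (11 / 12) : ℂ)) := by
  have hpi := ofReal_ne_zero.mpr Real.pi_ne_zero
  have ht := ofReal_ne_zero.mpr fourthRootThree_pos.ne'
  have ht4 : (fourthRootThree : ℂ) ^ 4 = 3 := by exact_mod_cast fourthRootThree_pow_four
  have c6 := kThree_converges (j := 6) (by norm_num) (by norm_num) 2
  have c4 := kThree_converges (j := 4) (by norm_num) (by norm_num) 3
  have c8 := kThree_converges (j := 8) (by norm_num) (by norm_num) 3
  have c3 := kThree_converges (j := 3) (by norm_num) (by norm_num) 4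
  have c2 := kThree_converges (j := 2) (by norm_num) (by norm_num) 6
  have c10 := kThree_converges (j := 10) (by norm_num) (by norm_num) 6
  have c1 := kThree_converges (j := 1) (by norm_num) (by norm_num) 12
  have c5 := kThree_converges (j := 5) (by norm_num) (by norm_num) 12
  have c7 := kThree_converges (j := 7) (by norm_num) (by norm_num) 12
  have c11 := kThree_converges (j := 11) (by norm_num) (by norm_num) 12
  have v6 := lValueOne_kThree (j := 6) (by norm_num) (by norm_num) 2
  have v4 := lValueOne_kThree (j := 4) (by norm_num) (by norm_num) 3
  have v8 := lValueOne_kThree (j := 8) (by norm_num) (by norm_num) 3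
  have v3 := lValueOne_kThree (j := 3) (by norm_num) (by norm_num) 4
  have v2 := lValueOne_kThree (j := 2) (by norm_num) (by norm_num) 6
  have v10 := lValueOne_kThree (j := 10) (by norm_num) (by norm_num) 6
  have v1 := lValueOne_kThree (j := 1) (by norm_num) (by norm_num) 12
  have v5 := lValueOne_kThree (j := 5) (by norm_num) (by norm_num) 12
  have v7 := lValueOne_kThree (j := 7) (by norm_num) (by norm_num) 12
  have v11 := lValueOne_kThree (j := 11) (by norm_num) (by norm_num) 12
  have e32 : (3 : ℝ) ^ (3 / 2 : ℝ) = fourthRootThree ^ 6 := by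
    rw [← rpow_eq_fourthRootThree_pow]
    norm_num
  have e14 : (3 : ℝ) ^ (1 / 4 : ℝ) = fourthRootThree := rfl
  have e54 : (3 : ℝ) ^ (5 / 4 : ℝ) = fourthRootThree ^ 5 := by
    rw [← rpow_eq_fourthRootThree_pow]
    norm_num
  have h15 : √15 = fourthRootThree ^ 2 * √5 := by
    rw [← sqrt_three_eq, ← Real.sqrt_mul (by norm_num)]
    norm_num
  -- Clearing the casts and reducing fractions such as `6 / 12` brings these facts to the form of
  -- the five eigenforms, which then match by unfolding.
  norm_num only [Nat.cast_ofNat, Nat.cast_one] at c6 c4 c8 c3 c2 c10 c1 c5 c7 c11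
  norm_num only [Nat.cast_ofNat, Nat.cast_one] at v6 v4 v8 v3 v2 v10 v1 v5 v7 v11
  refine ⟨fun j h1 h11 ↦ ?_, ⟨c6, c4.add (c8.const_mul _), c3, c2.add (c10.const_mul _),
    ((c1.add (c5.const_mul _)).sub (c7.const_mul _)).sub (c11.const_mul _)⟩, ?_, ?_, ⟨?_, ?_⟩,
    ?_, ?_⟩
  · have h1' : (1 : ℝ) ≤ j := by exact_mod_cast h1
    have h11' : (j : ℝ) ≤ 11 := by exact_mod_cast h11
    exact CubicHyp.summable_threeFTwoTerm (by positivity) (by linarith)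
  · rw [show lValueOne f_12_3_c_a = _ from v6]
    field_simp
    linear_combination (-4 * threePTwo (1 / 2) : ℂ) * ht4
  · rw [show lValueOne f_27_3_b_b = _ from lValueOne_add c4 (c8.const_mul _),
      lValueOne_const_mul, v4, v8, e32]
    push_cast
    field_simp
    linear_combination (threePTwo (1 / 3) : ℂ) * ht4
  · rw [show lValueOne f_16_3_c_a = _ from v3, e14]
    field_simp
    ring
  · rw [sqrt_three_eq]
    exact threePTwo_one_quarter
  · rw [show lValueOne f_108_3_c_b = _ from lValueOne_add c2 (c10.const_mul _),
      lValueOne_const_mul, v2, v10]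
    field_simp
    linear_combination (-12 * I * threePTwo (5 / 6) * (fourthRootThree ^ 4 + 3)) * ht4
  · rw [show lValueOne f_432_3_g_e = _ from lValueOne_sub ((c1.add (c5.const_mul _)).sub
      (c7.const_mul _)) (c11.const_mul _), lValueOne_sub (c1.add (c5.const_mul _))
      (c7.const_mul _), lValueOne_add c1 (c5.const_mul _), lValueOne_const_mul,
      lValueOne_const_mul, lValueOne_const_mul, v1, v5, v7, v11, e54, h15, sqrt_three_eq]
    push_cast
    field_simp
    linear_combination (8 * fourthRootThree ^ 4 * threePTwo (1 / 12) +
      24 * I * threePTwo (11 / 12)) * ht4
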